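/- **Theorem (Composition-Diamond lemma for dialgebras; Bokut, Chen, Liu).** Let $k$ be a field and $X$ a well-ordered set. A dialgebra is a $k$-space with two bilinear associative products $\vdash,\dashv$ such that $a\dashv(b\vdash c)=(a\dashv b)\dashv c$, $(a\dashv b)\vdash c=a\vdash(b\vdash c)$ and $a\vdash(b\dashv c)=(a\vdash b)\dashv c$. Let $D(X)$ be the free dialgebra on $X$. It has as linear basis the set $[X^*]$ of normal diwords $[u]=x_{-m}\vdash\cdots\vdash x_{-1}\vdash x_0\dashv x_1\dashv\cdots\dashv x_n$ ($m,n\ge 0$, $x_i\in X$), where $x_0$ is the center and $|u|=m+n+1$ the length. Order $[X^*]$ by comparing the weights $(n+m+1,\,m,\,x_{-m},\dots,x_n)$ lexicographically. For $0\ne f\in D(X)$ let $[\bar f]$ be its leading (largest) diword and $\deg f=|\bar f|$; $f$ is monic if $[\bar f]$ has coefficient $1$. Call $f$ left (right) normed if in every diword occurring in $f$ the center is the last (first) letter. For $s\in D(X)$, an $s$-diword $[asb]$ is obtained from some $x_{-m}\vdash\cdots\vdash x_0\dashv\cdots\dashv x_n$ by substituting $s$ for one letter $x_j$, where $a=x_{-m}\cdots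 x_{j-1}$ and $b=x_{j+1}\cdots x_n$ (possibly empty); substituting $[\bar s]$ instead of $s$ gives the diword $[a[\bar s]b]$. The $s$-diword is normal if $j=0$, or $j<0$ and $s$ is left normed, or $j>0$ and $s$ is right normed. A normal $s$-diword is a left (right) normed $s$-diword if both $s$ and $[asb]$ are left (right) normed. Normal $S$-diwords, for a set $S$, are the normal $s$-diwords with $s\in S$; left and right normed $S$-diwords are defined likewise. Let $S\subset D(X)$ be a set of monic elements. Its compositions are, for $f,g\in S$ and $x\in X$: 1. (left multiplication) $x\dashv f$, if $f$ is not right normed; (right multiplication) $f\vdash x$, if $f$ is not left normed; 2. (inclusion) $(f,g)_{[w]}=f-[agb]$, if $[w]=[\bar f]=[a[\bar g]b]$ with $[agb]$ a normal $g$-diword; 3. (intersection) $(f,g)_{[w]}=[fb]-[ag]$, if $[w]=[[\bar f]b]=[a[\bar g]]$ with $|\bar f|+|\bar g|>|w|$, $[fb]$ a normal $f$-diword and $[ag]$ a normal $g$-diword. $S$ is a Gröbner–Shirshov basis if: every composition $x\dashv f$ (resp. $f\vdash x$) is a linear combination of right (resp. left) normed $S$-diwords $[a_is_ib_i]$ with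 $|a_i\bar s_ib_i|\le\deg(x\dashv f)$ (resp. $\le\deg(f\vdash x)$); and every composition $(f,g)_{[w]}$ is a linear combination of normal $S$-diwords $[a_is_ib_i]$ with $[a_i[\bar s_i]b_i]<[w]$, all of which are right (left) normed $S$-diwords whenever the two $S$-diwords whose difference is $(f,g)_{[w]}$ are both right (left) normed. Let $Id(S)$ be the ideal of $D(X)$ generated by $S$ and $D(X|S)=D(X)/Id(S)$. Then $(i)\Rightarrow(ii)\Leftrightarrow(iii)\Rightarrow(iv)$, where - (i) $S$ is a Gröbner–Shirshov basis in $D(X)$. - (ii) For every nonzero $f\in Id(S)$ there are $s\in S$ and a normal $S$-diword $[asb]$ with $[\bar f]=[a[\bar s]b]$. - (iii) The set $Irr(S)$ of those $u\in[X^*]$ that are not of the form $[a[\bar s]b]$ with $s\in S$ and $[asb]$ a normal $S$-diword is a linear basis of $D(X|S)$ (that is, the images of its members are linearly independent and span). - (iv) Each composition $h$ is trivial modulo $S$: $h$ is a linear combination of normal $S$-diwords $[a_is_ib_i]$ with $[a_i[\bar s_i]b_i]\le[\bar h]$, and with $[a_i[\bar s_i]b_i]<[w]$ if $h=(f,g)_{[w]}$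 (the zero composition being trivial). -/

import Mathlib

/-! ### Dialgebras -/

/-- The two operations `⊢` and `⊣` of a dialgebra, written `⊢ᵈ` and `⊣ᵈ`. -/
class DiMul (D : Type*) where
  vdash : D → D → D
  dashv : D → D → D

infixl:70 " ⊢ᵈ " => DiMul.vdash
infixl:70 " ⊣ᵈ " => DiMul.dashv

/-- A dialgebra over `k`: two bilinear associative operations satisfying the three mixed laws. -/
class Dialgebra (k D : Type*) [Field k] [AddCommGroup D] [Module k D] extends DiMul D where
  vdash_add : ∀ a b c : D, a ⊢ᵈ (b + c) = a ⊢ᵈ b + a ⊢ᵈ c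
  add_vdash : ∀ a b c : D, (a + b) ⊢ᵈ c = a ⊢ᵈ c + b ⊢ᵈ c
  vdash_smul : ∀ (r : k) (a b : D), a ⊢ᵈ (r • b) = r • (a ⊢ᵈ b)
  smul_vdash : ∀ (r : k) (a b : D), (r • a) ⊢ᵈ b = r • (a ⊢ᵈ b)
  dashv_add : ∀ a b c : D, a ⊣ᵈ (b + c) = a ⊣ᵈ b + a ⊣ᵈ c
  add_dashv : ∀ a b c : D, (a + b) ⊣ᵈ c = a ⊣ᵈ c + b ⊣ᵈ c
  dashv_smul : ∀ (r : k) (a b : D), a ⊣ᵈ (r • b) = r • (a ⊣ᵈ b)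
  smul_dashv : ∀ (r : k) (a b : D), (r • a) ⊣ᵈ b = r • (a ⊣ᵈ b)
  vdash_assoc : ∀ a b c : D, (a ⊢ᵈ b) ⊢ᵈ c = a ⊢ᵈ (b ⊢ᵈ c)
  dashv_assoc : ∀ a b c : D, (a ⊣ᵈ b) ⊣ᵈ c = a ⊣ᵈ (b ⊣ᵈ c)
  dashv_vdash : ∀ a b c : D, a ⊣ᵈ (b ⊢ᵈ c) = (a ⊣ᵈ b) ⊣ᵈ c
  vdash_of_dashv : ∀ a b c : D, (a ⊣ᵈ b) ⊢ᵈ c = a ⊢ᵈ (b ⊢ᵈ c)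
  vdash_dashv : ∀ a b c : D, a ⊢ᵈ (b ⊣ᵈ c) = (a ⊢ᵈ b) ⊣ᵈ c

/-- A (two-sided) ideal of a dialgebra. -/
def IsDiIdeal {k D : Type*} [Field k] [AddCommGroup D] [Module k D] [Dialgebra k D]
    (I : Submodule k D) : Prop :=
  ∀ a ∈ I, ∀ d : D, a ⊢ᵈ d ∈ I ∧ d ⊢ᵈ a ∈ I ∧ a ⊣ᵈ d ∈ I ∧ d ⊣ᵈ a ∈ I

/-- `Id(S)`, the smallest ideal containing `S`. -/
def diIdeal (k : Type*) {D : Type*} [Field k] [AddCommGroup D] [Module k D] [Dialgebra k D]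
    (S : Set D) : Submodule k D :=
  sInf {I : Submodule k D | IsDiIdeal I ∧ S ⊆ I}

theorem diIdeal_isDiIdeal (k : Type*) {D : Type*} [Field k] [AddCommGroup D] [Module k D]
    [Dialgebra k D] (S : Set D) : IsDiIdeal (diIdeal k S) := by
  intro a ha d
  simp only [diIdeal, Submodule.mem_sInf] at ha ⊢
  exact ⟨fun I hI => (hI.1 a (ha I hI) d).1, fun I hI => (hI.1 a (ha I hI) d).2.1,
    fun I hI => (hI.1 a (ha I hI) d).2.2.1, fun I hI => (hI.1 a (ha I hI) d).2.2.2⟩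

/-- An operation that is additive in both arguments and absorbs a submodule `I` on both sides
respects congruence modulo `I`. -/
theorem diQuotient_aux {k D : Type*} [Field k] [AddCommGroup D] [Module k D]
    (I : Submodule k D) (op : D → D → D)
    (h1 : ∀ a b c, op a (b + c) = op a b + op a c) (h2 : ∀ a b c, op (a + b) c = op a c + op b c)
    (h3 : ∀ a ∈ I, ∀ d, op a d ∈ I ∧ op d a ∈ I) (a a' : D) (ha : (Submodule.quotientRel I) a a')
    (b b' : D) (hb : (Submodule.quotientRel I) b b') :
    (Submodule.quotientRel I) (op a b) (op a' b') := by
  rw [Submodule.quotientRel_def] at *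
  have e1 : op a b = op (a - a') b + op a' b := by rw [← h2, sub_add_cancel]
  have e2 : op a' b = op a' (b - b') + op a' b' := by rw [← h1, sub_add_cancel]
  have : op a b - op a' b' = op (a - a') b + op a' (b - b') := by rw [e1, e2]; abel
  rw [this]
  exact I.add_mem (h3 _ ha _).1 (h3 _ hb _).2

/-- The quotient dialgebra `D / Id(S)`. -/
instance diQuotient (k : Type*) {D : Type*} [Field k] [AddCommGroup D] [Module k D]
    [Dialgebra k D] (S : Set D) : Dialgebra k (D ⧸ diIdeal k S) where
  vdash := Quotient.map₂ (· ⊢ᵈ ·) (fun _ _ ha _ _ hb => diQuotient_aux (diIdeal k S) _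
    (Dialgebra.vdash_add (k := k)) (Dialgebra.add_vdash (k := k)) (fun a h d =>
      ⟨(diIdeal_isDiIdeal k S a h d).1, (diIdeal_isDiIdeal k S a h d).2.1⟩) _ _ ha _ _ hb)
  dashv := Quotient.map₂ (· ⊣ᵈ ·) (fun _ _ ha _ _ hb => diQuotient_aux (diIdeal k S) _
    (Dialgebra.dashv_add (k := k)) (Dialgebra.add_dashv (k := k)) (fun a h d =>
      ⟨(diIdeal_isDiIdeal k S a h d).2.2.1, (diIdeal_isDiIdeal k S a h d).2.2.2⟩) _ _ ha _ _ hb)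
  vdash_add := by
    rintro ⟨a⟩ ⟨b⟩ ⟨c⟩; exact congrArg (Submodule.Quotient.mk) (Dialgebra.vdash_add (k := k) a b c)
  add_vdash := by
    rintro ⟨a⟩ ⟨b⟩ ⟨c⟩; exact congrArg (Submodule.Quotient.mk) (Dialgebra.add_vdash (k := k) a b c)
  vdash_smul := by
    rintro r ⟨a⟩ ⟨b⟩; exact congrArg (Submodule.Quotient.mk) (Dialgebra.vdash_smul r a b)
  smul_vdash := by
    rintro r ⟨a⟩ ⟨b⟩; exact congrArg (Submodule.Quotient.mk) (Dialgebra.smul_vdash r a b)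
  dashv_add := by
    rintro ⟨a⟩ ⟨b⟩ ⟨c⟩; exact congrArg (Submodule.Quotient.mk) (Dialgebra.dashv_add (k := k) a b c)
  add_dashv := by
    rintro ⟨a⟩ ⟨b⟩ ⟨c⟩; exact congrArg (Submodule.Quotient.mk) (Dialgebra.add_dashv (k := k) a b c)
  dashv_smul := by
    rintro r ⟨a⟩ ⟨b⟩; exact congrArg (Submodule.Quotient.mk) (Dialgebra.dashv_smul r a b)
  smul_dashv := by
    rintro r ⟨a⟩ ⟨b⟩; exact congrArg (Submodule.Quotient.mk) (Dialgebra.smul_dashv r a b)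
  vdash_assoc := by
    rintro ⟨a⟩ ⟨b⟩ ⟨c⟩; exact congrArg (Submodule.Quotient.mk) (Dialgebra.vdash_assoc (k := k) a b c)
  dashv_assoc := by
    rintro ⟨a⟩ ⟨b⟩ ⟨c⟩; exact congrArg (Submodule.Quotient.mk) (Dialgebra.dashv_assoc (k := k) a b c)
  dashv_vdash := by
    rintro ⟨a⟩ ⟨b⟩ ⟨c⟩; exact congrArg (Submodule.Quotient.mk) (Dialgebra.dashv_vdash (k := k) a b c)
  vdash_of_dashv := by
    rintro ⟨a⟩ ⟨b⟩ ⟨c⟩; exact congrArg (Submodule.Quotient.mk) (Dialgebra.vdash_of_dashv (k := k) a b c)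
  vdash_dashv := by
    rintro ⟨a⟩ ⟨b⟩ ⟨c⟩; exact congrArg (Submodule.Quotient.mk) (Dialgebra.vdash_dashv (k := k) a b c)

/-! ### Normal diwords and the free dialgebra -/

/-- The normal diword `x_{-m} ⊢ ⋯ ⊢ x_{-1} ⊢ x_0 ⊣ x_1 ⊣ ⋯ ⊣ x_n`, with
`left = [x_{-m}, …, x_{-1}]`, `center = x_0` and `right = [x_1, …, x_n]`. -/
@[ext]
structure Diword (X : Type*) where
  left : List X
  center : X
  right : List X

namespace Diword

variable {X : Type*}

/-- The underlying associative word. -/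
def word (u : Diword X) : List X := u.left ++ u.center :: u.right

/-- The length `m + n + 1`. -/
def length (u : Diword X) : ℕ := u.word.length

/-- The one-letter diword. -/
def of (x : X) : Diword X := ⟨[], x, []⟩

/-- `u ⊢ v` and `u ⊣ v` are the concatenation of `u` and `v` with the center of `v`,
respectively of `u`. -/
instance : DiMul (Diword X) where
  vdash u v := ⟨u.word ++ v.left, v.center, v.right⟩
  dashv u v := ⟨u.left, u.center, u.right ++ v.word⟩

/-- The weight `(n + m + 1, m, x_{-m}, …, x_n)`, in the lexicographic product. -/
def wt (u : Diword X) : ℕ ×ₗ (ℕ ×ₗ List X) := toLex (u.length, toLex (u.left.length, u.word))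

theorem wt_injective : Function.Injective (wt : Diword X → _) := by
  rintro ⟨a, x, b⟩ ⟨a', x', b'⟩ h
  have h' := congrArg ofLex h
  simp only [wt, ofLex_toLex, Prod.mk.injEq] at h'
  have h2 := congrArg ofLex h'.2
  simp only [ofLex_toLex, Prod.mk.injEq, word] at h2
  obtain ⟨h3, h4⟩ := List.append_inj h2.2 h2.1
  simp_all

/-- The deg-lex order: diwords are compared by their weights, lexicographically. -/
noncomputable instance [LinearOrder X] : LinearOrder (Diword X) :=
  LinearOrder.lift' wt wt_injective

end Diword

/-- `x_1 ⊢ (x_2 ⊢ ⋯ (x_r ⊢ d))` for a list of letters `[x_1, …, x_r]` interpreted by `ι`. -/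
def vdashList {X D : Type*} [DiMul D] (ι : X → D) (a : List X) (d : D) : D :=
  a.foldr (fun x e => ι x ⊢ᵈ e) d

/-- `((d ⊣ x_1) ⊣ x_2) ⋯ ⊣ x_r` for a list of letters `[x_1, …, x_r]` interpreted by `ι`. -/
def dashvList {X D : Type*} [DiMul D] (ι : X → D) (d : D) (b : List X) : D :=
  b.foldl (fun e x => e ⊣ᵈ ι x) d

/-- The value of a normal diword when its letters are interpreted by `ι`. -/
def Diword.eval {X D : Type*} [DiMul D] (ι : X → D) (u : Diword X) : D :=
  dashvList ι (vdashList ι u.left (ι u.center)) u.right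

/-- The free dialgebra `D(X)`, with linear basis the normal diwords. -/
abbrev FreeDialgebra (k X : Type*) [Field k] : Type _ := Diword X →₀ k

namespace FreeDialgebra

variable {k X : Type*} [Field k]

/-- The bilinear extension of an operation on diwords. -/
noncomputable def ext₂ (op : Diword X → Diword X → Diword X) :
    FreeDialgebra k X →ₗ[k] FreeDialgebra k X →ₗ[k] FreeDialgebra k X :=
  Finsupp.linearCombination k (fun u => Finsupp.lmapDomain k k (op u))

theorem ext₂_single (op : Diword X → Diword X → Diword X) (u v : Diword X) (r s : k) :
    ext₂ op (Finsupp.single u r) (Finsupp.single v s) = Finsupp.single (op u v) (r * s) := by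
  simp [ext₂, Finsupp.linearCombination_single, Finsupp.mapDomain_single]

theorem ext₂_assoc (o1 o2 o3 o4 : Diword X → Diword X → Diword X)
    (h : ∀ u v w, o1 (o2 u v) w = o3 u (o4 v w)) (a b c : FreeDialgebra k X) :
    ext₂ o1 (ext₂ o2 a b) c = ext₂ o3 a (ext₂ o4 b c) := by
  induction a using Finsupp.induction_linear with
  | zero => simp
  | add f g hf hg => simp [hf, hg]
  | single u r =>
    induction b using Finsupp.induction_linear with
    | zero => simp
    | add f g hf hg => simp [hf, hg]
    | single v s =>
      induction c using Finsupp.induction_linear with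
      | zero => simp
      | add f g hf hg => simp [hf, hg]
      | single w t => rw [ext₂_single, ext₂_single, ext₂_single, ext₂_single, h, mul_assoc]

noncomputable instance : DiMul (FreeDialgebra k X) where
  vdash f g := ext₂ (· ⊢ᵈ ·) f g
  dashv f g := ext₂ (· ⊣ᵈ ·) f g

noncomputable instance : Dialgebra k (FreeDialgebra k X) where
  vdash_add a b c := by simp [DiMul.vdash]
  add_vdash a b c := by simp [DiMul.vdash]
  vdash_smul r a b := by simp [DiMul.vdash]
  smul_vdash r a b := by simp [DiMul.vdash]
  dashv_add a b c := by simp [DiMul.dashv]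
  add_dashv a b c := by simp [DiMul.dashv]
  dashv_smul r a b := by simp [DiMul.dashv]
  smul_dashv r a b := by simp [DiMul.dashv]
  vdash_assoc := ext₂_assoc _ _ _ _ (by intros; simp [DiMul.vdash, Diword.word])
  dashv_assoc := ext₂_assoc _ _ _ _ (by intros; simp [DiMul.dashv, Diword.word])
  dashv_vdash a b c := (ext₂_assoc _ _ _ _
    (by intros; simp [DiMul.vdash, DiMul.dashv, Diword.word]) a b c).symm
  vdash_of_dashv := ext₂_assoc _ _ _ _
    (by intros; simp [DiMul.vdash, DiMul.dashv, Diword.word])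
  vdash_dashv a b c := (ext₂_assoc _ _ _ _
    (by intros; simp [DiMul.vdash, DiMul.dashv]) a b c).symm

/-- The generators of `D(X)`. -/
noncomputable def of (k : Type*) {X : Type*} [Field k] (x : X) : FreeDialgebra k X :=
  Finsupp.single (Diword.of x) 1

end FreeDialgebra

/-! The universal property, which shows that `FreeDialgebra k X` is the free dialgebra. -/

section Universal

variable {k X D : Type*} [Field k] [AddCommGroup D] [Module k D] [Dialgebra k D]

theorem vdashList_vdash (φ : X → D) (a : List X) (d e : D) :
    vdashList φ a d ⊢ᵈ e = vdashList φ a (d ⊢ᵈ e) := by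
  induction a with
  | nil => rfl
  | cons x a ih => simp only [vdashList, List.foldr_cons] at ih ⊢; rw [Dialgebra.vdash_assoc (k := k), ih]

theorem vdashList_dashv (φ : X → D) (a : List X) (d e : D) :
    vdashList φ a d ⊣ᵈ e = vdashList φ a (d ⊣ᵈ e) := by
  induction a with
  | nil => rfl
  | cons x a ih => simp only [vdashList, List.foldr_cons] at ih ⊢; rw [← Dialgebra.vdash_dashv (k := k), ih]

theorem vdashList_dashvList (φ : X → D) (a b : List X) (d : D) :
    dashvList φ (vdashList φ a d) b = vdashList φ a (dashvList φ d b) := by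
  induction b generalizing d with
  | nil => rfl
  | cons x b ih =>
    have := ih (d ⊣ᵈ φ x)
    simp only [dashvList, List.foldl_cons] at this ⊢
    rw [vdashList_dashv (k := k), this]

theorem dashvList_vdash (φ : X → D) (b : List X) (d e : D) :
    dashvList φ d b ⊢ᵈ e = d ⊢ᵈ vdashList φ b e := by
  induction b generalizing d with
  | nil => rfl
  | cons x b ih =>
    have := ih (d ⊣ᵈ φ x)
    simp only [dashvList, vdashList, List.foldl_cons, List.foldr_cons] at this ⊢
    rw [this, Dialgebra.vdash_of_dashv (k := k)]

theorem dashv_vdashList (φ : X → D) (a : List X) (d e : D) :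
    d ⊣ᵈ vdashList φ a e = dashvList φ d a ⊣ᵈ e := by
  induction a generalizing d with
  | nil => rfl
  | cons x a ih =>
    have := ih (d ⊣ᵈ φ x)
    simp only [dashvList, vdashList, List.foldl_cons, List.foldr_cons] at this ⊢
    rw [← this, Dialgebra.dashv_vdash (k := k)]

theorem dashv_dashvList (φ : X → D) (b : List X) (d e : D) :
    d ⊣ᵈ dashvList φ e b = dashvList φ (d ⊣ᵈ e) b := by
  induction b generalizing e with
  | nil => rfl
  | cons x b ih =>
    have := ih (e ⊣ᵈ φ x)
    simp only [dashvList, List.foldl_cons] at this ⊢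
    rw [this, Dialgebra.dashv_assoc (k := k)]

theorem vdash_dashvList (φ : X → D) (b : List X) (d e : D) :
    d ⊢ᵈ dashvList φ e b = dashvList φ (d ⊢ᵈ e) b := by
  induction b generalizing e with
  | nil => rfl
  | cons x b ih =>
    have := ih (e ⊣ᵈ φ x)
    simp only [dashvList, List.foldl_cons] at this ⊢
    rw [this, Dialgebra.vdash_dashv (k := k)]

theorem Diword.eval_vdash (φ : X → D) (u v : Diword X) :
    (u ⊢ᵈ v).eval φ = u.eval φ ⊢ᵈ v.eval φ := by
  have h : vdashList φ (u.word ++ v.left) (φ v.center)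
      = u.eval φ ⊢ᵈ vdashList φ v.left (φ v.center) := by
    rw [Diword.eval, dashvList_vdash (k := k), vdashList_vdash (k := k)]
    simp [vdashList, Diword.word]
  change dashvList φ (vdashList φ (u.word ++ v.left) (φ v.center)) v.right = _
  rw [h, ← vdash_dashvList (k := k)]; rfl

theorem Diword.eval_dashv (φ : X → D) (u v : Diword X) :
    (u ⊣ᵈ v).eval φ = u.eval φ ⊣ᵈ v.eval φ := by
  have h : u.eval φ ⊣ᵈ v.eval φ = dashvList φ (u.eval φ) (v.left ++ v.center :: v.right) := by
    rw [Diword.eval, Diword.eval, dashv_dashvList (k := k), dashv_vdashList (k := k)]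
    simp [dashvList]
  rw [h]
  change dashvList φ (vdashList φ u.left (φ u.center)) (u.right ++ v.word) = _
  simp [dashvList, Diword.eval, Diword.word]

theorem FreeDialgebra.vdash_single (u v : Diword X) :
    (Finsupp.single u 1 : FreeDialgebra k X) ⊢ᵈ (Finsupp.single v 1 : FreeDialgebra k X)
      = Finsupp.single (u ⊢ᵈ v) 1 := by
  have := FreeDialgebra.ext₂_single (k := k) (· ⊢ᵈ ·) u v 1 1
  rw [one_mul] at this
  exact this

theorem FreeDialgebra.dashv_single (u v : Diword X) :
    (Finsupp.single u 1 : FreeDialgebra k X) ⊣ᵈ (Finsupp.single v 1 : FreeDialgebra k X)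
      = Finsupp.single (u ⊣ᵈ v) 1 := by
  have := FreeDialgebra.ext₂_single (k := k) (· ⊣ᵈ ·) u v 1 1
  rw [one_mul] at this
  exact this

/-- A normal diword is the product of its letters in `D(X)`. -/
theorem FreeDialgebra.eval_of (u : Diword X) :
    u.eval (FreeDialgebra.of k) = Finsupp.single u (1 : k) := by
  have h1 : ∀ (a : List X) (v : Diword X),
      vdashList (FreeDialgebra.of k) a (Finsupp.single v (1 : k))
        = Finsupp.single (⟨a ++ v.left, v.center, v.right⟩ : Diword X) 1 := by
    intro a v
    induction a with
    | nil => rfl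
    | cons x a ih =>
      simp only [vdashList, List.foldr_cons] at ih ⊢
      rw [ih, FreeDialgebra.of, FreeDialgebra.vdash_single]
      rfl
  have h2 : ∀ (b : List X) (v : Diword X),
      dashvList (FreeDialgebra.of k) (Finsupp.single v (1 : k)) b
        = Finsupp.single (⟨v.left, v.center, v.right ++ b⟩ : Diword X) 1 := by
    intro b
    induction b with
    | nil => intro v; simp [dashvList]
    | cons x b ih =>
      intro v
      have := ih (v ⊣ᵈ Diword.of x)
      simp only [dashvList, List.foldl_cons] at this ⊢
      rw [FreeDialgebra.of, FreeDialgebra.dashv_single, this]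
      simp [DiMul.dashv, Diword.of, Diword.word]
  rw [Diword.eval, FreeDialgebra.of, h1, h2]
  simp [Diword.of]

theorem FreeDialgebra.universal (φ : X → D) :
    ∃! F : FreeDialgebra k X →ₗ[k] D, (∀ x, F (FreeDialgebra.of k x) = φ x) ∧
      (∀ f g, F (f ⊢ᵈ g) = F f ⊢ᵈ F g) ∧ (∀ f g, F (f ⊣ᵈ g) = F f ⊣ᵈ F g) := by
  have hext : ∀ (op : Diword X → Diword X → Diword X) (op' : D → D → D)
      (F : FreeDialgebra k X →ₗ[k] D),
      (∀ u v, F (Finsupp.single (op u v) 1) = op' (F (Finsupp.single u 1)) (F (Finsupp.single v 1))) →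
      (∀ a b c, op' a (b + c) = op' a b + op' a c) → (∀ a b c, op' (a + b) c = op' a c + op' b c) →
      (∀ (r : k) a b, op' a (r • b) = r • op' a b) → (∀ (r : k) a b, op' (r • a) b = r • op' a b) →
      ∀ f g, F (FreeDialgebra.ext₂ op f g) = op' (F f) (F g) := by
    intro op op' F h h1 h2 h3 h4 f g
    have hz1 : ∀ b, op' 0 b = 0 := fun b => by simpa using h4 0 0 b
    have hz2 : ∀ b, op' b 0 = 0 := fun b => by simpa using h3 0 b 0
    induction f using Finsupp.induction_linear with
    | zero => simp [hz1]
    | add f g hf hg => simp [hf, hg, h2]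
    | single u r =>
      induction g using Finsupp.induction_linear with
      | zero => simp [hz2]
      | add f g hf hg => simp [hf, hg, h1]
      | single v s =>
        have e : ∀ (w : Diword X) (t : k), (Finsupp.single w t : FreeDialgebra k X)
            = t • Finsupp.single w 1 := fun w t => by simp
        rw [FreeDialgebra.ext₂_single, e u r, e v s, e (op u v), map_smul, map_smul, map_smul,
          h, h3, h4, smul_smul, mul_comm]
  refine ⟨Finsupp.linearCombination k (Diword.eval φ), ⟨fun x => ?_, ?_, ?_⟩, ?_⟩
  · simp [FreeDialgebra.of, Diword.of, Diword.eval, dashvList, vdashList]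
  · exact hext _ _ _ (fun u v => by simp [Diword.eval_vdash (k := k)]) (Dialgebra.vdash_add (k := k))
      (Dialgebra.add_vdash (k := k)) Dialgebra.vdash_smul Dialgebra.smul_vdash
  · exact hext _ _ _ (fun u v => by simp [Diword.eval_dashv (k := k)]) (Dialgebra.dashv_add (k := k))
      (Dialgebra.add_dashv (k := k)) Dialgebra.dashv_smul Dialgebra.smul_dashv
  · rintro F ⟨hF, hv, hd⟩
    have h1 : ∀ (a : List X) d, F (vdashList (FreeDialgebra.of k) a d) = vdashList φ a (F d) := by
      intro a d
      induction a with
      | nil => rfl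
      | cons x a ih => simp only [vdashList, List.foldr_cons] at ih ⊢; rw [hv, ih, hF]
    have h2 : ∀ (b : List X) d, F (dashvList (FreeDialgebra.of k) d b) = dashvList φ (F d) b := by
      intro b
      induction b with
      | nil => intro d; rfl
      | cons x b ih =>
        intro d
        have := ih (d ⊣ᵈ FreeDialgebra.of k x)
        simp only [dashvList, List.foldl_cons] at this ⊢
        rw [this, hd, hF]
    ext u
    simp only [LinearMap.comp_apply, Finsupp.lsingle_apply, Finsupp.linearCombination_single,
      one_smul]
    rw [← FreeDialgebra.eval_of, Diword.eval, h2, h1, hF]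
    rfl

end Universal

/-! ### Leading diwords and normal `S`-diwords -/

namespace FreeDialgebra

variable {k X : Type*} [Field k]

/-- The leading diword of `f`; it is `⊥` exactly for `f = 0`. -/
noncomputable def lead [LinearOrder X] (f : FreeDialgebra k X) : WithBot (Diword X) :=
  f.support.max

/-- The degree of `f`, the length of its leading diword; it is `⊥` exactly for `f = 0`. -/
noncomputable def deg [LinearOrder X] (f : FreeDialgebra k X) : WithBot ℕ :=
  (lead f).map Diword.length

/-- `f` is nonzero with leading coefficient `1`. -/
def Monic [LinearOrder X] (f : FreeDialgebra k X) : Prop :=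
  ∃ u : Diword X, lead f = u ∧ f u = 1

/-- Every diword of `f` has its last letter as center: `f = ∑ αᵢ uᵢ ⊢ xᵢ`. -/
def LeftNormed (f : FreeDialgebra k X) : Prop := ∀ u ∈ f.support, u.right = []

/-- Every diword of `f` has its first letter as center: `f = ∑ αᵢ xᵢ ⊣ uᵢ`. -/
def RightNormed (f : FreeDialgebra k X) : Prop := ∀ u ∈ f.support, u.left = []

end FreeDialgebra

/-- A normal diword in which one letter is replaced by a hole, to be filled with an element `s`:
* `hole a b` is `a ⊢ s ⊣ b` (the hole is the center);
* `holeLeft a v` is `a ⊢ s ⊢ v` (the hole is to the left of the center, which lies in `v`);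
* `holeRight v b` is `v ⊣ s ⊣ b` (the hole is to the right of the center, which lies in `v`). -/
inductive DiContext (X : Type*) where
  | hole (a b : List X)
  | holeLeft (a : List X) (v : Diword X)
  | holeRight (v : Diword X) (b : List X)

namespace DiContext

/-- Fill the hole with `s`, the letters being interpreted by `ι`. -/
def fill {X D : Type*} [DiMul D] (ι : X → D) : DiContext X → D → D
  | hole a b, s => dashvList ι (vdashList ι a s) b
  | holeLeft a v, s => vdashList ι a (s ⊢ᵈ v.eval ι)
  | holeRight v b, s => dashvList ι (v.eval ι ⊣ᵈ s) b

variable {k X : Type*} [Field k]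

/-- The `s`-diword `[a s b]` of `D(X)`. -/
noncomputable def app (C : DiContext X) (s : FreeDialgebra k X) : FreeDialgebra k X :=
  C.fill (FreeDialgebra.of k) s

/-- The diword `[a [u] b]`. -/
def appWord (C : DiContext X) (u : Diword X) : Diword X := C.fill Diword.of u

/-- The associative word `a` before the hole. -/
def before : DiContext X → List X
  | hole a _ => a
  | holeLeft a _ => a
  | holeRight v _ => v.word

/-- The associative word `b` after the hole. -/
def after : DiContext X → List X
  | hole _ b => b
  | holeLeft _ v => v.word
  | holeRight _ b => b

/-- `[a s b]` is a normal `s`-diword: the hole is the center, or it is to the left of the center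
and `s` is left normed, or it is to the right of the center and `s` is right normed. -/
def Normal (C : DiContext X) (s : FreeDialgebra k X) : Prop :=
  match C with
  | hole _ _ => True
  | holeLeft _ _ => s.LeftNormed
  | holeRight _ _ => s.RightNormed

/-- `[a s b]` is a left normed `s`-diword. -/
def LeftNormed (C : DiContext X) (s : FreeDialgebra k X) : Prop :=
  C.Normal s ∧ s.LeftNormed ∧ (C.app s).LeftNormed

/-- `[a s b]` is a right normed `s`-diword. -/
def RightNormed (C : DiContext X) (s : FreeDialgebra k X) : Prop :=
  C.Normal s ∧ s.RightNormed ∧ (C.app s).RightNormed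

end DiContext

/-! ### Compositions and Gröbner–Shirshov bases -/

namespace FreeDialgebra

variable {k X : Type*} [Field k] [LinearOrder X]

/-- The normal `S`-diwords `[a s b]` such that the leading diword `[a [s̄] b]`, the context and `s`
satisfy the condition `P`. -/
def normalDiwords (S : Set (FreeDialgebra k X))
    (P : DiContext X → FreeDialgebra k X → Diword X → Prop) : Set (FreeDialgebra k X) :=
  {h | ∃ s ∈ S, ∃ (C : DiContext X) (u : Diword X),
    C.Normal s ∧ lead s = u ∧ P C s (C.appWord u) ∧ h = C.app s}

/-- `IsComposition f g C E w`: the `f`-diword `C.app f` and the `g`-diword `E.app g` form a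
composition of inclusion or of intersection `(f, g)_{[w]} = C.app f - E.app g`. -/
inductive IsComposition (f g : FreeDialgebra k X) : DiContext X → DiContext X → Diword X → Prop
  /-- Inclusion: `[w] = [f̄] = [a [ḡ] b]` with `[a g b]` normal; the composition is `f - [a g b]`. -/
  | inclusion (E : DiContext X) (w v : Diword X) (hf : lead f = w) (hg : lead g = v)
      (hE : E.Normal g) (hw : w = E.appWord v) : IsComposition f g (DiContext.hole [] []) E w
  /-- Intersection: `[w] = [[f̄] b] = [a [ḡ]]` with `[f b]` and `[a g]` normal and
  `|f̄| + |ḡ| > |w|`; the composition is `[f b] - [a g]`. -/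
  | intersection (C E : DiContext X) (w u v : Diword X) (hf : lead f = u) (hg : lead g = v)
      (hC : C.Normal f) (hE : E.Normal g) (hCb : C.before = []) (hEa : E.after = [])
      (hwf : w = C.appWord u) (hwg : w = E.appWord v) (hlen : w.length < u.length + v.length) :
      IsComposition f g C E w

/-- `S` is a Gröbner–Shirshov basis:
* each composition of left multiplication `x ⊣ f` (`f ∈ S` not right normed) is a linear
  combination of right normed `S`-diwords of degree at most `deg (x ⊣ f)`;
* each composition of right multiplication `f ⊢ x` (`f ∈ S` not left normed) is a linear
  combination of left normed `S`-diwords of degree at most `deg (f ⊢ x)`;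
* each composition of inclusion or intersection is a linear combination of normal `S`-diwords with
  leading diwords less than `[w]`, which are right (left) normed `S`-diwords whenever the two
  `S`-diwords that form the composition are both right (left) normed. -/
def IsGroebnerShirshov (S : Set (FreeDialgebra k X)) : Prop :=
  (∀ f ∈ S, ∀ x : X, ¬ f.RightNormed →
    of k x ⊣ᵈ f ∈ Submodule.span k (normalDiwords S fun C s u =>
      C.RightNormed s ∧ (u.length : WithBot ℕ) ≤ deg (of k x ⊣ᵈ f))) ∧
  (∀ f ∈ S, ∀ x : X, ¬ f.LeftNormed →
    f ⊢ᵈ of k x ∈ Submodule.span k (normalDiwords S fun C s u =>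
      C.LeftNormed s ∧ (u.length : WithBot ℕ) ≤ deg (f ⊢ᵈ of k x))) ∧
  (∀ f ∈ S, ∀ g ∈ S, ∀ (C E : DiContext X) (w : Diword X), IsComposition f g C E w →
    C.app f - E.app g ∈ Submodule.span k (normalDiwords S fun B s u => u < w ∧
      (C.RightNormed f → E.RightNormed g → B.RightNormed s) ∧
      (C.LeftNormed f → E.LeftNormed g → B.LeftNormed s)))

/-- Each composition is trivial modulo `S`: it is a linear combination of normal `S`-diwords whose
leading diwords do not exceed that of the composition (and are less than `[w]` in the case of
inclusion and intersection), with no requirement of being left or right normed. -/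
def CompositionsTrivial (S : Set (FreeDialgebra k X)) : Prop :=
  (∀ f ∈ S, ∀ x : X, ¬ f.RightNormed →
    of k x ⊣ᵈ f ∈ Submodule.span k (normalDiwords S fun _ _ u => u ≤ lead (of k x ⊣ᵈ f))) ∧
  (∀ f ∈ S, ∀ x : X, ¬ f.LeftNormed →
    f ⊢ᵈ of k x ∈ Submodule.span k (normalDiwords S fun _ _ u => u ≤ lead (f ⊢ᵈ of k x))) ∧
  (∀ f ∈ S, ∀ g ∈ S, ∀ (C E : DiContext X) (w : Diword X), IsComposition f g C E w →
    C.app f - E.app g ∈ Submodule.span k (normalDiwords S fun _ _ u =>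
      u ≤ lead (C.app f - E.app g) ∧ u < w))

/-- `[u] = [a [s̄] b]` for some `s ∈ S` and some normal `S`-diword `[a s b]`. -/
def Reducible (S : Set (FreeDialgebra k X)) (u : Diword X) : Prop :=
  ∃ s ∈ S, ∃ (C : DiContext X) (v : Diword X), C.Normal s ∧ lead s = v ∧ u = C.appWord v

/-- The leading diword of every nonzero element of `Id(S)` has the form `[a [s̄] b]`, with
`s ∈ S` and `[a s b]` a normal `S`-diword. -/
def LeadProperty (S : Set (FreeDialgebra k X)) : Prop :=
  ∀ f ∈ diIdeal k S, f ≠ 0 → ∃ u : Diword X, lead f = u ∧ Reducible S u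

/-- The set of `S`-irreducible normal diwords. -/
def Irr (S : Set (FreeDialgebra k X)) : Set (Diword X) := {u | ¬ Reducible S u}

/-- The images of the diwords in `Irr(S)` form a linear basis of `D(X|S) = D(X) / Id(S)`. -/
def IrrIsBasis (S : Set (FreeDialgebra k X)) : Prop :=
  LinearIndependent k (fun u : Irr S =>
    (diIdeal k S).mkQ (Finsupp.single (u : Diword X) (1 : k))) ∧
  Submodule.span k (Set.range fun u : Irr S =>
    (diIdeal k S).mkQ (Finsupp.single (u : Diword X) (1 : k))) = ⊤

end FreeDialgebra

/-! ### The deg-lex order on diwords -/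

namespace Diword

variable {X : Type*}

/-! Substituting `s` for a letter off the center forgets the centers of the diwords of `s`, so
leading terms may merge or cancel. Normality prevents this: it makes substitution strictly monotone
on the support of `s`, so for monic `s` the element `[asb]` has leading diword `[a[s̄]b]` with
coefficient 1 (`lead_app`).

For (i) ⇒ (ii), the multiplication compositions show that normal `S`-diwords span `Id(S)`
(`diIdeal_le_normalSpan`): if the hole is off center and `s` is not normed, the product of `s` with
the adjacent letter on the side of the center is such a composition. The other compositions show
that two normal `S`-diwords with the same leading diword differ by smaller ones
(`app_sub_app_mem_lowerSpan`). For disjoint occurrences of the leading words this is bilinearity;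
for nested or overlapping ones a composition sits inside an outer context, and if the center lies
outside it, the normedness clause of the definition keeps its terms normal. Now write an element of
the ideal with normal `S`-diwords bounded by `w`, and merge those with leading diword `w` into one.
Either its coefficient survives and `w` is the leading diword of the element, or the bound drops;
the order is well-founded.

For the rest, division by normal `S`-diwords writes any `f` as irreducible diwords plus normal
`S`-diwords, all bounded by the leading diword of `f` (`mem_irrSpan_sup`). So `Irr(S)` always spans
the quotient, and both (ii) and (iii) say that `Id(S)` meets the span of `Irr(S)` trivially
(`IrrIndependent`). Then division of an element of `Id(S)` leaves no irreducible part, which for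
compositions is (iv). -/

theorem length_eq (u : Diword X) : u.length = u.left.length + u.right.length + 1 := by
  simp only [length, word, List.length_append, List.length_cons]; omega

theorem length_word (u : Diword X) : u.word.length = u.left.length + u.right.length + 1 :=
  u.length_eq

theorem eq_of_word_eq {u v : Diword X} (hw : u.word = v.word)
    (hl : u.left.length = v.left.length) : u = v :=
  wt_injective (by simp only [wt, length, hw, hl])

/-- If the center of `v` lies beyond the prefix `p` of its word, then `p` is a prefix of the left
part of `v`. -/
theorem exists_left_split {v : Diword X} {p q : List X} (h : v.word = p ++ q)
    (hl : p.length ≤ v.left.length) :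
    ∃ l, v = ⟨p ++ l, v.center, v.right⟩ ∧ q = l ++ v.center :: v.right := by
  obtain ⟨a, x, b⟩ := v
  simp only [word] at h hl ⊢
  rcases List.append_eq_append_iff.1 h with ⟨c, rfl, hc⟩ | ⟨c, rfl, rfl⟩
  · have : c = [] := by
      apply List.eq_nil_of_length_eq_zero
      rw [List.length_append] at hl; omega
    subst this
    exact ⟨[], by simp, by simpa using hc.symm⟩
  · exact ⟨c, rfl, rfl⟩

/-- If the center of `v` lies in the prefix `p` of its word, then the rest is a suffix of the right
part of `v`. -/
theorem exists_right_split {v : Diword X} {p q : List X} (h : v.word = p ++ q)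
    (hl : v.left.length < p.length) :
    ∃ r, v = ⟨v.left, v.center, r ++ q⟩ ∧ p = v.left ++ v.center :: r := by
  obtain ⟨a, x, b⟩ := v
  simp only [word] at h hl ⊢
  rcases List.append_eq_append_iff.1 h with ⟨c, rfl, hc⟩ | ⟨c, rfl, rfl⟩
  · rcases c with _ | ⟨y, c⟩
    · simp at hl
    · simp only [List.cons_append, List.cons.injEq] at hc
      obtain ⟨rfl, rfl⟩ := hc
      exact ⟨c, rfl, rfl⟩
  · rw [List.length_append] at hl; omega

variable [LinearOrder X]

theorem lt_iff {u v : Diword X} : u < v ↔ u.length < v.length ∨ u.length = v.length ∧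
    (u.left.length < v.left.length ∨ u.left.length = v.left.length ∧ u.word < v.word) := by
  change wt u < wt v ↔ _
  simp [wt, Prod.Lex.toLex_lt_toLex]

/-- Equal lengths matter: a proper prefix is lexicographically smaller, and a common suffix can
reverse that comparison. -/
theorem append_right_lt {l l' : List X} (h : l.length = l'.length) (hl : l < l') (b : List X) :
    l ++ b < l' ++ b := by
  induction l generalizing l' with
  | nil => cases l' with
    | nil => exact absurd hl (lt_irrefl _)
    | cons y l' => simp at h
  | cons x l ih => cases l' with
    | nil => simp at h
    | cons y l' =>
      simp only [List.cons_append, List.cons_lt_cons_iff, List.length_cons,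
        Nat.add_right_cancel_iff] at *
      exact hl.imp_right fun h' => ⟨h'.1, ih h h'.2⟩

theorem append_lt_append {l l' : List X} (h : l.length = l'.length) (hl : l < l') (a b : List X) :
    a ++ l ++ b < a ++ l' ++ b :=
  append_right_lt (by simp [h]) (List.append_left_lt hl) b

/-- The lexicographic order on words of all lengths is not well-founded in general, but it is
consulted only for words of equal length, where it implies the well-founded shortlex order. -/
instance [WellFoundedLT X] : WellFoundedLT (Diword X) where
  wf := by
    have h := (wellFounded_lt (α := ℕ)).prod_lex ((wellFounded_lt (α := ℕ)).prod_lex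
      (List.Shortlex.wf (wellFounded_lt (α := X))))
    refine Subrelation.wf ?_ (InvImage.wf
      (fun u : Diword X => (u.length, u.left.length, u.word)) h)
    intro u v huv
    simp only [InvImage, Prod.lex_def]
    rcases lt_iff.1 huv with h | ⟨h, h' | ⟨h', hw⟩⟩
    · exact Or.inl h
    · exact Or.inr ⟨h, Or.inl h'⟩
    · exact Or.inr ⟨h, Or.inr ⟨h', List.Shortlex.of_lex h hw⟩⟩

end Diword

/-! ### Contexts -/

theorem vdashList_of {X : Type*} (a : List X) (u : Diword X) :
    vdashList Diword.of a u = ⟨a ++ u.left, u.center, u.right⟩ := by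
  induction a with
  | nil => rfl
  | cons x a ih =>
    simp only [vdashList, List.foldr_cons] at ih ⊢
    rw [ih]; rfl

theorem dashvList_of {X : Type*} (b : List X) (u : Diword X) :
    dashvList Diword.of u b = ⟨u.left, u.center, u.right ++ b⟩ := by
  induction b generalizing u with
  | nil => simp [dashvList]
  | cons x b ih =>
    have := ih (u ⊣ᵈ Diword.of x)
    simp only [dashvList, List.foldl_cons] at this ⊢
    rw [this]
    simp [DiMul.dashv, Diword.of, Diword.word]

theorem Diword.eval_of_self {X : Type*} (u : Diword X) : u.eval Diword.of = u := by
  rw [Diword.eval, vdashList_of, dashvList_of]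
  simp [Diword.of]

namespace DiContext

variable {X : Type*}

@[simp] theorem appWord_hole (a b : List X) (u : Diword X) :
    (hole a b).appWord u = ⟨a ++ u.left, u.center, u.right ++ b⟩ := by
  simp [appWord, fill, vdashList_of, dashvList_of]

@[simp] theorem appWord_holeLeft (a : List X) (v u : Diword X) :
    (holeLeft a v).appWord u = ⟨a ++ u.word ++ v.left, v.center, v.right⟩ := by
  simp [appWord, fill, vdashList_of, Diword.eval_of_self, DiMul.vdash]

@[simp] theorem appWord_holeRight (v : Diword X) (b : List X) (u : Diword X) :
    (holeRight v b).appWord u = ⟨v.left, v.center, v.right ++ u.word ++ b⟩ := by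
  simp [appWord, fill, dashvList_of, Diword.eval_of_self, DiMul.dashv]

theorem word_appWord (C : DiContext X) (u : Diword X) :
    (C.appWord u).word = C.before ++ u.word ++ C.after := by
  cases C <;> simp [Diword.word, before, after]

/-- Substitution of a context into the hole of another one. -/
def comp : DiContext X → DiContext X → DiContext X
  | hole a b, hole a' b' => hole (a ++ a') (b' ++ b)
  | hole a b, holeLeft a' v => holeLeft (a ++ a') ⟨v.left, v.center, v.right ++ b⟩
  | hole a b, holeRight v b' => holeRight ⟨a ++ v.left, v.center, v.right⟩ (b' ++ b)
  | holeLeft a v, B => holeLeft (a ++ B.before) ⟨B.after ++ v.left, v.center, v.right⟩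
  | holeRight v b, B => holeRight ⟨v.left, v.center, v.right ++ B.before⟩ (B.after ++ b)

/-- An outer context with its hole off center retains only the word of what is inserted, so the
inner context matters only through `before` and `after`. -/
theorem appWord_comp (O B : DiContext X) (u : Diword X) :
    (O.comp B).appWord u = O.appWord (B.appWord u) := by
  cases O with
  | hole a b => cases B <;> simp [comp, Diword.word]
  | holeLeft a v => simp [comp, word_appWord]
  | holeRight v b => simp [comp, word_appWord]

/-- The diword `u` may be substituted into the context so as to give a normal diword. -/
def Fits (C : DiContext X) (u : Diword X) : Prop :=
  match C with
  | hole _ _ => True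
  | holeLeft _ _ => u.right = []
  | holeRight _ _ => u.left = []

/-- At the center, substitution shifts the left length by a constant. Off center it forgets where
the center of `u` was; `Fits` puts that center at an end of the word, so that length and word
determine `u`. -/
theorem appWord_lt [LinearOrder X] {C : DiContext X} {u v : Diword X} (hu : C.Fits u)
    (hv : C.Fits v) (h : u < v) : C.appWord u < C.appWord v := by
  have key : (C.appWord u).word < (C.appWord v).word ∨ u.length ≠ v.length ∨ ¬ u.word < v.word := by
    by_cases hl : u.length = v.length
    · by_cases hw : u.word < v.word
      · left
        rw [word_appWord, word_appWord]
        exact Diword.append_lt_append hl hw _ _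
      · simp [hw]
    · simp [hl]
  rw [Diword.lt_iff] at h ⊢
  cases C with
  | hole a b =>
    simp only [appWord_hole, Diword.length_eq, List.length_append] at *
    rcases h with h | ⟨h, h' | ⟨h', hw⟩⟩
    · left; omega
    · right; exact ⟨by omega, Or.inl (by omega)⟩
    · right; exact ⟨by omega, Or.inr ⟨by omega, by tauto⟩⟩
  | holeLeft a w =>
    simp only [Fits, appWord_holeLeft, Diword.length_eq, Diword.length_word, List.length_append]
      at *
    have hu' := congrArg List.length hu
    have hv' := congrArg List.length hv
    simp only [List.length_nil] at hu' hv'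
    rcases h with h | ⟨h, h' | ⟨h', hw⟩⟩
    · left; omega
    -- Equal lengths and empty right parts leave no room for different left lengths.
    · omega
    · right; exact ⟨by omega, Or.inr ⟨by omega, by tauto⟩⟩
  | holeRight w b =>
    simp only [Fits, appWord_holeRight, Diword.length_eq, Diword.length_word, List.length_append]
      at *
    have hu' := congrArg List.length hu
    have hv' := congrArg List.length hv
    simp only [List.length_nil] at hu' hv'
    rcases h with h | ⟨h, h' | ⟨h', hw⟩⟩
    · left; omega
    · omega
    · right; exact ⟨by omega, Or.inr ⟨trivial, by tauto⟩⟩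

theorem appWord_le [LinearOrder X] {C : DiContext X} {u v : Diword X} (hu : C.Fits u)
    (hv : C.Fits v) (h : u ≤ v) : C.appWord u ≤ C.appWord v := by
  rcases h.lt_or_eq with h | rfl
  · exact (appWord_lt hu hv h).le
  · exact le_rfl

variable {k : Type*} [Field k]

theorem Normal.fits {C : DiContext X} {s : FreeDialgebra k X} (h : C.Normal s) {u : Diword X}
    (hu : u ∈ s.support) : C.Fits u := by
  cases C
  · trivial
  · exact h u hu
  · exact h u hu

end DiContext

/-! ### Products and substitutions as linear extensions of maps of diwords -/

namespace FreeDialgebra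

variable {k X : Type*} [Field k]

theorem single_vdash (u : Diword X) (f : FreeDialgebra k X) :
    (Finsupp.single u 1 : FreeDialgebra k X) ⊢ᵈ f = f.mapDomain (u ⊢ᵈ ·) := by
  change ext₂ _ _ _ = _
  simp [ext₂]

theorem single_dashv (u : Diword X) (f : FreeDialgebra k X) :
    (Finsupp.single u 1 : FreeDialgebra k X) ⊣ᵈ f = f.mapDomain (u ⊣ᵈ ·) := by
  change ext₂ _ _ _ = _
  simp [ext₂]

theorem ext₂_single_right (op : Diword X → Diword X → Diword X) (f : FreeDialgebra k X)
    (u : Diword X) : ext₂ op f (Finsupp.single u 1) = f.mapDomain (op · u) := by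
  induction f using Finsupp.induction_linear with
  | zero => simp
  | add f g hf hg => rw [map_add, LinearMap.add_apply, hf, hg, Finsupp.mapDomain_add]
  | single v r => rw [ext₂_single, Finsupp.mapDomain_single, mul_one]

theorem vdash_single_right (f : FreeDialgebra k X) (u : Diword X) :
    f ⊢ᵈ (Finsupp.single u 1 : FreeDialgebra k X) = f.mapDomain (· ⊢ᵈ u) :=
  ext₂_single_right _ _ _

theorem dashv_single_right (f : FreeDialgebra k X) (u : Diword X) :
    f ⊣ᵈ (Finsupp.single u 1 : FreeDialgebra k X) = f.mapDomain (· ⊣ᵈ u) :=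
  ext₂_single_right _ _ _

theorem vdashList_eq_mapDomain (a : List X) (f : FreeDialgebra k X) :
    vdashList (of k) a f = f.mapDomain (vdashList Diword.of a) := by
  induction a with
  | nil => exact (Finsupp.mapDomain_id).symm
  | cons x a ih =>
    simp only [vdashList, List.foldr_cons] at ih ⊢
    rw [ih, of, single_vdash, ← Finsupp.mapDomain_comp]
    rfl

theorem dashvList_eq_mapDomain (b : List X) (f : FreeDialgebra k X) :
    dashvList (of k) f b = f.mapDomain (dashvList Diword.of · b) := by
  induction b generalizing f with
  | nil => exact (Finsupp.mapDomain_id).symm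
  | cons x b ih =>
    have := ih (f ⊣ᵈ of k x)
    simp only [dashvList, List.foldl_cons] at this ⊢
    rw [this, of, dashv_single_right, ← Finsupp.mapDomain_comp]
    rfl

end FreeDialgebra

namespace DiContext

open FreeDialgebra

variable {k X : Type*} [Field k]

theorem app_eq_mapDomain (C : DiContext X) (s : FreeDialgebra k X) :
    C.app s = s.mapDomain C.appWord := by
  cases C with
  | hole a b =>
    rw [app, fill, vdashList_eq_mapDomain, dashvList_eq_mapDomain, ← Finsupp.mapDomain_comp]
    rfl
  | holeLeft a v =>
    rw [app, fill, eval_of, vdash_single_right, vdashList_eq_mapDomain, ← Finsupp.mapDomain_comp]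
    congr 1
    funext u
    simp only [appWord, fill, Diword.eval_of_self, Function.comp_def]
  | holeRight v b =>
    rw [app, fill, eval_of, single_dashv, dashvList_eq_mapDomain, ← Finsupp.mapDomain_comp]
    congr 1
    funext u
    simp only [appWord, fill, Diword.eval_of_self, Function.comp_def]

theorem app_comp (O B : DiContext X) (s : FreeDialgebra k X) :
    (O.comp B).app s = O.app (B.app s) := by
  rw [app_eq_mapDomain, app_eq_mapDomain, app_eq_mapDomain, ← Finsupp.mapDomain_comp]
  congr 1
  exact funext fun u => appWord_comp O B u

/-- Substitution into a context, as a linear map. -/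
noncomputable def appLin (k : Type*) [Field k] (C : DiContext X) :
    FreeDialgebra k X →ₗ[k] FreeDialgebra k X :=
  Finsupp.lmapDomain k k C.appWord

theorem appLin_apply (C : DiContext X) (s : FreeDialgebra k X) : C.appLin k s = C.app s :=
  (app_eq_mapDomain C s).symm

theorem exists_of_mem_support_app {C : DiContext X} {s : FreeDialgebra k X} {t : Diword X}
    (h : t ∈ (C.app s).support) : ∃ u ∈ s.support, C.appWord u = t := by
  classical
  rw [app_eq_mapDomain] at h
  simpa using Finsupp.mapDomain_support h

/-- Strict monotonicity makes `C.appWord` injective on the support of a normally placed `s`, so no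
coefficients are added together. -/
theorem Normal.app_apply [LinearOrder X] {C : DiContext X} {s : FreeDialgebra k X}
    (h : C.Normal s) {u : Diword X} (hu : u ∈ s.support) : C.app s (C.appWord u) = s u := by
  rw [app_eq_mapDomain]
  refine Finsupp.mapDomain_apply' (s.support : Set _) s subset_rfl ?_ hu
  intro a ha b hb hab
  rcases lt_trichotomy a b with hlt | heq | hgt
  · exact absurd hab (appWord_lt (h.fits ha) (h.fits hb) hlt).ne
  · exact heq
  · exact absurd hab (appWord_lt (h.fits hb) (h.fits ha) hgt).ne'

end DiContext

/-! ### Leading diwords of elements and of normal `S`-diwords -/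

namespace FreeDialgebra

variable {k X : Type*} [Field k] [LinearOrder X]

theorem lead_eq_coe_iff {f : FreeDialgebra k X} {u : Diword X} :
    lead f = u ↔ f u ≠ 0 ∧ ∀ t, f t ≠ 0 → t ≤ u := by
  constructor
  · intro h
    exact ⟨Finsupp.mem_support_iff.1 (Finset.mem_of_max h),
      fun t ht => Finset.le_max_of_eq (Finsupp.mem_support_iff.2 ht) h⟩
  · rintro ⟨h1, h2⟩
    refine le_antisymm ?_ (Finset.le_max (Finsupp.mem_support_iff.2 h1))
    exact Finset.max_le fun t ht => WithBot.coe_le_coe.2 (h2 t (Finsupp.mem_support_iff.1 ht))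

theorem exists_lead_eq {f : FreeDialgebra k X} (h : f ≠ 0) : ∃ u : Diword X, lead f = u := by
  obtain ⟨u, hu⟩ := Finset.max_of_nonempty (Finsupp.support_nonempty_iff.2 h)
  exact ⟨u, hu⟩

theorem Monic.apply_lead {f : FreeDialgebra k X} (h : f.Monic) {u : Diword X} (hu : lead f = u) :
    f u = 1 := by
  obtain ⟨v, hv, h1⟩ := h
  rw [hu, WithBot.coe_inj] at hv
  rw [hv, h1]

theorem mem_support_of_lead {f : FreeDialgebra k X} {u : Diword X} (hu : lead f = u) :
    u ∈ f.support :=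
  Finset.mem_of_max hu

theorem le_of_lead {f : FreeDialgebra k X} {u t : Diword X} (hu : lead f = u)
    (ht : t ∈ f.support) : t ≤ u :=
  Finset.le_max_of_eq ht hu

theorem lead_app {C : DiContext X} {s : FreeDialgebra k X} (hC : C.Normal s) {u : Diword X}
    (hu : lead s = u) : lead (C.app s) = C.appWord u := by
  have hm := mem_support_of_lead hu
  rw [lead_eq_coe_iff, hC.app_apply hm]
  refine ⟨Finsupp.mem_support_iff.1 hm, fun t ht => ?_⟩
  obtain ⟨v, hv, rfl⟩ := DiContext.exists_of_mem_support_app (Finsupp.mem_support_iff.2 ht)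
  exact DiContext.appWord_le (hC.fits hv) (hC.fits hm) (le_of_lead hu hv)

end FreeDialgebra

/-! ### Spans of normal `S`-diwords -/

namespace DiContext

variable {k X : Type*} [Field k]

theorem Normal.hole_comp {B : DiContext X} {s : FreeDialgebra k X} (h : B.Normal s)
    (a b : List X) : ((hole a b).comp B).Normal s := by
  cases B <;> exact h

/-- The left normed context `a ⊢ s ⊢ e`, whose center is its last letter. -/
def leftHole (a : List X) : List X → DiContext X
  | [] => hole a []
  | x :: l => holeLeft a ⟨(x :: l).dropLast, (x :: l).getLast (List.cons_ne_nil x l), []⟩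

/-- The right normed context `a ⊣ s ⊣ e`, whose center is its first letter. -/
def rightHole : List X → List X → DiContext X
  | [], e => hole [] e
  | x :: l, e => holeRight ⟨[], x, l⟩ e

@[simp] theorem before_leftHole (a e : List X) : (leftHole a e).before = a := by
  cases e <;> rfl

@[simp] theorem after_leftHole (a e : List X) : (leftHole a e).after = e := by
  cases e with
  | nil => rfl
  | cons x l =>
    simp only [leftHole, after, Diword.word]
    exact List.dropLast_append_getLast _

@[simp] theorem before_rightHole (a e : List X) : (rightHole a e).before = a := by
  cases a <;> simp [rightHole, before, Diword.word]

@[simp] theorem after_rightHole (a e : List X) : (rightHole a e).after = e := by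
  cases a <;> rfl

theorem right_appWord_leftHole (a e : List X) {u : Diword X} (hu : u.right = []) :
    ((leftHole a e).appWord u).right = [] := by
  cases e <;> simp [leftHole, hu]

theorem left_appWord_rightHole (a e : List X) {u : Diword X} (hu : u.left = []) :
    ((rightHole a e).appWord u).left = [] := by
  cases a <;> simp [rightHole, hu]

theorem leftNormed_leftHole (a e : List X) {s : FreeDialgebra k X} (hs : s.LeftNormed) :
    (leftHole a e).LeftNormed s := by
  refine ⟨by cases e; exacts [trivial, hs], hs, fun t ht => ?_⟩
  obtain ⟨u, hu, rfl⟩ := exists_of_mem_support_app ht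
  exact right_appWord_leftHole a e (hs u hu)

theorem rightNormed_rightHole (a e : List X) {s : FreeDialgebra k X} (hs : s.RightNormed) :
    (rightHole a e).RightNormed s := by
  refine ⟨by cases a; exacts [trivial, hs], hs, fun t ht => ?_⟩
  obtain ⟨u, hu, rfl⟩ := exists_of_mem_support_app ht
  exact left_appWord_rightHole a e (hs u hu)

theorem app_mem_of_mem_span {T : Set (FreeDialgebra k X)} {N : Submodule k (FreeDialgebra k X)}
    (O : DiContext X) (h : ∀ t ∈ T, O.app t ∈ N) {f : FreeDialgebra k X}
    (hf : f ∈ Submodule.span k T) : O.app f ∈ N := by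
  have := (Submodule.map_span_le (O.appLin k) T N).2
    (fun t ht => by rw [appLin_apply]; exact h t ht) (Submodule.mem_map_of_mem hf)
  rwa [appLin_apply] at this

theorem app_sub (O : DiContext X) (f g : FreeDialgebra k X) :
    O.app (f - g) = O.app f - O.app g := by
  simp only [← appLin_apply, map_sub]

theorem app_eq_sum (C : DiContext X) (s : FreeDialgebra k X) :
    C.app s = s.sum fun t r => Finsupp.single (C.appWord t) r := by
  rw [app_eq_mapDomain]; rfl

end DiContext

theorem Diword.eq_of_right_eq_nil {X : Type*} {u v : Diword X} (h : u.word = v.word)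
    (hu : u.right = []) (hv : v.right = []) : u = v := by
  refine eq_of_word_eq h ?_
  have := congrArg List.length h
  rw [length_word, length_word, hu, hv] at this
  simpa using this

theorem Diword.eq_of_left_eq_nil {X : Type*} {u v : Diword X} (h : u.word = v.word)
    (hu : u.left = []) (hv : v.left = []) : u = v :=
  eq_of_word_eq h (by rw [hu, hv])

namespace FreeDialgebra

open DiContext

variable {k X : Type*} [Field k] [LinearOrder X] {S : Set (FreeDialgebra k X)}

/-- The span of the normal `S`-diwords with leading diword less than `w`. -/
noncomputable def lowerSpan (S : Set (FreeDialgebra k X)) (w : Diword X) :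
    Submodule k (FreeDialgebra k X) :=
  Submodule.span k (normalDiwords S fun _ _ u => u < w)

/-- The span of all normal `S`-diwords. -/
noncomputable def normalSpan (S : Set (FreeDialgebra k X)) : Submodule k (FreeDialgebra k X) :=
  Submodule.span k (normalDiwords S fun _ _ _ => True)

theorem app_mem_lowerSpan {s : FreeDialgebra k X} (hs : s ∈ S) {C : DiContext X}
    (hC : C.Normal s) {u w : Diword X} (hu : lead s = u) (hw : C.appWord u < w) :
    C.app s ∈ lowerSpan S w :=
  Submodule.subset_span ⟨s, hs, C, u, hC, hu, hw, rfl⟩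

theorem app_mem_normalSpan (hS : ∀ s ∈ S, Monic s) {s : FreeDialgebra k X} (hs : s ∈ S)
    {C : DiContext X} (hC : C.Normal s) : C.app s ∈ normalSpan S := by
  obtain ⟨u, hu, -⟩ := hS s hs
  exact Submodule.subset_span ⟨s, hs, C, u, hC, hu, trivial, rfl⟩

/-- Inclusion is the case of a trivial context around `f`, so both kinds of composition can be
handled alike. -/
theorem IsComposition.exists_lead {f g : FreeDialgebra k X} {C E : DiContext X} {w : Diword X}
    (h : IsComposition f g C E w) :
    (C.Normal f ∧ ∃ u : Diword X, lead f = u ∧ w = C.appWord u) ∧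
      E.Normal g ∧ ∃ v : Diword X, lead g = v ∧ w = E.appWord v := by
  rcases h with ⟨_, _, v, hf, hg, hE, hw⟩ | ⟨_, _, _, u, v, hf, hg, hC, hE, _, _, hwf, hwg, _⟩
  · exact ⟨⟨trivial, w, hf, by simp⟩, hE, v, hg, hw⟩
  · exact ⟨⟨hC, u, hf, hwf⟩, hE, v, hg, hwg⟩

/-- A composition of inclusion or intersection stays trivial inside an outer context, if the hole
of the latter is its center, or if all `S`-diwords involved are normed on the proper side. -/
theorem comp_app_sub_mem_lowerSpan (hG : IsGroebnerShirshov S) {f g : FreeDialgebra k X}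
    (hf : f ∈ S) (hg : g ∈ S) {C E : DiContext X} {w : Diword X} (h : IsComposition f g C E w)
    (O : DiContext X) (hO : match O with
      | hole _ _ => True
      | holeLeft _ _ => C.LeftNormed f ∧ E.LeftNormed g
      | holeRight _ _ => C.RightNormed f ∧ E.RightNormed g) :
    (O.comp C).app f - (O.comp E).app g ∈ lowerSpan S (O.appWord w) := by
  have hmem := hG.2.2 f hf g hg C E w h
  rw [app_comp, app_comp, ← app_sub]
  obtain ⟨⟨hCn, u₀, hu₀, rfl⟩, -⟩ := h.exists_lead
  -- `w` occurs in `C.app f`, hence is normed whenever `C.app f` is; this lets it fit into an outer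
  -- context with its hole off center.
  have hw := mem_support_of_lead (lead_app hCn hu₀)
  refine app_mem_of_mem_span O ?_ hmem
  rintro _ ⟨s, hs, B, u, hB, hu, ⟨hlt, hR, hL⟩, rfl⟩
  have hBu := mem_support_of_lead (lead_app hB hu)
  rw [← app_comp]
  cases O with
  | hole a b =>
    refine app_mem_lowerSpan hs (hB.hole_comp a b) hu ?_
    rw [appWord_comp]
    exact appWord_lt trivial trivial hlt
  | holeLeft a v =>
    -- The center of `O` lies to the right, so `B.app s` may be inserted only if left normed, which
    -- the normedness clause for compositions provides.
    have hB' := hL hO.1 hO.2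
    refine app_mem_lowerSpan hs (C := comp (holeLeft a v) B) hB'.2.1 hu ?_
    rw [appWord_comp]
    exact appWord_lt (hB'.2.2 _ hBu) (hO.1.2.2 _ hw) hlt
  | holeRight v b =>
    have hB' := hR hO.1 hO.2
    refine app_mem_lowerSpan hs (C := comp (holeRight v b) B) hB'.2.1 hu ?_
    rw [appWord_comp]
    exact appWord_lt (hB'.2.2 _ hBu) (hO.1.2.2 _ hw) hlt

/-- Since `s` is monic, the term of the sum at `u` is exactly `F u`; the other terms come from
smaller diwords. -/
theorem sum_smul_sub_mem {s : FreeDialgebra k X} (hm : s.Monic) {u : Diword X} (hu : lead s = u)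
    {N : Submodule k (FreeDialgebra k X)} (F : Diword X → FreeDialgebra k X)
    (h : ∀ t ∈ s.support, t < u → F t ∈ N) : (s.sum fun t r => r • F t) - F u ∈ N := by
  have h1 : (s.sum fun t r => r • F t) - F u = ∑ t ∈ s.support.erase u, s t • F t := by
    rw [Finsupp.sum, ← Finset.add_sum_erase _ _ (mem_support_of_lead hu), hm.apply_lead hu,
      one_smul, add_sub_cancel_left]
  rw [h1]
  refine N.sum_mem fun t ht => N.smul_mem _ ?_
  rw [Finset.mem_erase] at ht
  exact h t ht.2 (lt_of_le_of_ne (le_of_lead hu ht.2) ht.1)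

/-- Two `S`-diwords obtained by filling one of the two holes of a diword with two holes by the
leading diword coincide modulo smaller normal `S`-diwords. -/
theorem app_sub_app_mem_of_two_holes (hS : ∀ s ∈ S, Monic s) {f g : FreeDialgebra k X}
    (hf : f ∈ S) (hg : g ∈ S) {u v : Diword X} (hu : lead f = u) (hv : lead g = v)
    (C E : Diword X → DiContext X) (hC : ∀ t ∈ g.support, (C t).Normal f)
    (hE : ∀ t ∈ f.support, (E t).Normal g)
    (h : ∀ t t', (C t').appWord t = (E t).appWord t') :
    (C v).app f - (E u).app g ∈ lowerSpan S ((C v).appWord u) := by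
  have hu' := mem_support_of_lead hu
  have hv' := mem_support_of_lead hv
  have h1 := sum_smul_sub_mem (N := lowerSpan S ((C v).appWord u)) (hS g hg) hv
    (fun t => (C t).app f) fun t ht htv => by
      refine app_mem_lowerSpan hf (hC t ht) hu ?_
      -- Seen from the other hole, the comparison is between substitutions of `t` and `v` into the
      -- single context `E u`.
      rw [h, h]
      exact appWord_lt ((hE u hu').fits ht) ((hE u hu').fits hv') htv
  have h2 := sum_smul_sub_mem (N := lowerSpan S ((C v).appWord u)) (hS f hf) hu
    (fun t => (E t).app g) fun t ht htu => by
      refine app_mem_lowerSpan hg (hE t ht) hv ?_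
      rw [← h]
      exact appWord_lt ((hC v hv').fits ht) ((hC v hv').fits hu') htu
  -- Both sums are the diword with two holes filled by `f` and `g` at once, expanded first along `g`
  -- or first along `f`.
  have h3 : (g.sum fun t r => r • (C t).app f) = f.sum fun t r => r • (E t).app g := by
    simp only [app_eq_sum, Finsupp.smul_sum, Finsupp.smul_single, smul_eq_mul, h]
    rw [Finsupp.sum_comm]
    simp only [mul_comm]
  rw [h3] at h1
  have := Submodule.sub_mem _ h2 h1
  rwa [sub_sub_sub_cancel_left] at this

/-- The occurrence of `v` starts after that of `u` ends, with `c` between them, so both `S`-diwords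
come from one diword with two holes. The center can be in `u`, in `v`, in `c`, or outside on either
side; the other pairs of contexts place it inconsistently and are excluded by counting letters. -/
theorem app_sub_app_mem_of_disjoint (hS : ∀ s ∈ S, Monic s) {f g : FreeDialgebra k X}
    (hf : f ∈ S) (hg : g ∈ S) {u v : Diword X} (hu : lead f = u) (hv : lead g = v)
    {C E : DiContext X} (hC : C.Normal f) (hE : E.Normal g) (hw : C.appWord u = E.appWord v)
    {c : List X} (hb : E.before = C.before ++ u.word ++ c)
    (ha : C.after = c ++ v.word ++ E.after) :
    C.app f - E.app g ∈ lowerSpan S (C.appWord u) := by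
  have hl := congrArg (fun t : Diword X => t.left.length) hw
  have hbl := congrArg List.length hb
  have hal := congrArg List.length ha
  cases C with
  | hole a b =>
    cases E with
    | hole a' b' =>
      simp only [before, after, appWord_hole, List.length_append, Diword.length_word] at *
      omega
    | holeLeft a' y =>
      simp only [before, after, appWord_hole, appWord_holeLeft, List.length_append,
        Diword.length_word] at *
      omega
    | holeRight y b' =>
      simp only [before, after, appWord_hole, appWord_holeRight, List.length_append,
        Diword.length_word] at *
      obtain rfl : y = ⟨a ++ u.left, u.center, u.right ++ c⟩ :=
        Diword.eq_of_word_eq (by rw [hb]; simp [Diword.word]) (by simp [← hl])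
      subst ha
      have := app_sub_app_mem_of_two_holes hS hf hg hu hv
        (fun t => hole a (c ++ t.word ++ b'))
        (fun t => holeRight ⟨a ++ t.left, t.center, t.right ++ c⟩ b')
        (fun _ _ => hC) (fun _ _ => hE) (fun t t' => by simp)
      simpa using this
  | holeLeft a y =>
    cases E with
    | hole a' b' =>
      simp only [before, after, appWord_hole, appWord_holeLeft, List.length_append,
        Diword.length_word] at *
      obtain rfl : y = ⟨c ++ v.left, v.center, v.right ++ b'⟩ :=
        Diword.eq_of_word_eq (by rw [ha]; simp [Diword.word])
          (by simp only [List.length_append]; omega)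
      subst hb
      have := app_sub_app_mem_of_two_holes hS hf hg hu hv
        (fun t => holeLeft a ⟨c ++ t.left, t.center, t.right ++ b'⟩)
        (fun t => hole (a ++ t.word ++ c) b')
        (fun _ _ => hC) (fun _ _ => hE) (fun t t' => by simp)
      simpa using this
    | holeLeft a' y' =>
      simp only [before, after, appWord_holeLeft, List.length_append,
        Diword.length_word] at *
      obtain rfl : y = ⟨c ++ v.word ++ y'.left, y'.center, y'.right⟩ :=
        Diword.eq_of_word_eq (by rw [ha]; simp [Diword.word])
          (by simp only [List.length_append, Diword.length_word]; omega)
      subst hb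
      have := app_sub_app_mem_of_two_holes hS hf hg hu hv
        (fun t => holeLeft a ⟨c ++ t.word ++ y'.left, y'.center, y'.right⟩)
        (fun t => holeLeft (a ++ t.word ++ c) y')
        (fun _ _ => hC) (fun _ _ => hE) (fun t t' => by simp)
      simpa using this
    | holeRight y' b' =>
      simp only [before, after, appWord_holeLeft, appWord_holeRight, List.length_append,
        Diword.length_word] at *
      -- Here the center lies in the gap `c`, between the two holes.
      obtain ⟨l, hy', rfl⟩ := Diword.exists_left_split hb
        (by simp only [List.length_append, Diword.length_word]; omega)
      obtain ⟨l', x, r⟩ := y'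
      simp only [Diword.mk.injEq, and_true] at hy'
      subst hy'
      obtain rfl : y = ⟨l, x, r ++ v.word ++ b'⟩ :=
        Diword.eq_of_word_eq (by rw [ha]; simp [Diword.word])
          (by simp only [List.length_append, Diword.length_word] at hl ⊢; omega)
      have := app_sub_app_mem_of_two_holes hS hf hg hu hv
        (fun t => holeLeft a ⟨l, x, r ++ t.word ++ b'⟩)
        (fun t => holeRight ⟨a ++ t.word ++ l, x, r⟩ b')
        (fun _ _ => hC) (fun _ _ => hE) (fun t t' => by simp)
      simpa using this
  | holeRight y b =>
    cases E with
    | hole a' b' =>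
      simp only [before, after, appWord_hole, appWord_holeRight, List.length_append,
        Diword.length_word] at *
      omega
    | holeLeft a' y' =>
      simp only [before, after, appWord_holeRight, appWord_holeLeft, List.length_append,
        Diword.length_word] at *
      omega
    | holeRight y' b' =>
      simp only [before, after, appWord_holeRight, List.length_append,
        Diword.length_word] at *
      obtain rfl : y' = ⟨y.left, y.center, y.right ++ u.word ++ c⟩ :=
        Diword.eq_of_word_eq (by rw [hb]; simp [Diword.word]) hl.symm
      subst ha
      have := app_sub_app_mem_of_two_holes hS hf hg hu hv
        (fun t => holeRight y (c ++ t.word ++ b'))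
        (fun t => holeRight ⟨y.left, y.center, y.right ++ t.word ++ c⟩ b')
        (fun _ _ => hC) (fun _ _ => hE) (fun t t' => by simp)
      simpa using this

end FreeDialgebra

/-! ### Nested and overlapping leading words -/

namespace FreeDialgebra

open DiContext

variable {k X : Type*} [Field k] [LinearOrder X] {S : Set (FreeDialgebra k X)}

/-- The occurrence of `v` lies inside that of `u`, so the difference is an inclusion composition
placed in the context `O` surrounding `u`. If the center is in `u`, the hole of `O` is its center.
Otherwise both holes lie on the same side of the center, so `f` and `g` are normed on the same side.
-/
theorem app_sub_app_mem_of_inclusion (hG : IsGroebnerShirshov S) {f g : FreeDialgebra k X}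
    (hf : f ∈ S) (hg : g ∈ S) {u v : Diword X} (hu : lead f = u) (hv : lead g = v)
    {C E : DiContext X} (hC : C.Normal f) (hE : E.Normal g) (hw : C.appWord u = E.appWord v)
    {c e : List X} (hb : E.before = C.before ++ c) (ha : E.after = e ++ C.after)
    (huv : u.word = c ++ v.word ++ e) :
    C.app f - E.app g ∈ lowerSpan S (C.appWord u) := by
  have hl := congrArg (fun t : Diword X => t.left.length) hw
  have hbl := congrArg List.length hb
  have hal := congrArg List.length ha
  have huvl := congrArg List.length huv
  have hur : C.Fits u := hC.fits (mem_support_of_lead hu)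
  have hvr : E.Fits v := hE.fits (mem_support_of_lead hv)
  suffices H : ∃ O E' : DiContext X, C = O.comp (hole [] []) ∧ E = O.comp E' ∧ E'.Normal g ∧
      u = E'.appWord v ∧ (match O with
      | hole _ _ => True
      | holeLeft _ _ => (hole [] []).LeftNormed f ∧ E'.LeftNormed g
      | holeRight _ _ => (hole [] []).RightNormed f ∧ E'.RightNormed g) by
    obtain ⟨O, E', rfl, rfl, hE', huE, hO⟩ := H
    have := comp_app_sub_mem_lowerSpan hG hf hg (.inclusion E' u v hu hv hE' huE) O hO
    rw [appWord_comp]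
    simpa using this
  cases C with
  | hole a b =>
    cases E with
    | hole a' b' =>
      simp only [before, after, appWord_hole, List.length_append, Diword.length_word] at *
      subst hb ha
      refine ⟨hole a b, hole c e, by simp [comp], by simp [comp], trivial, ?_, trivial⟩
      refine Diword.eq_of_word_eq (by rw [huv, word_appWord]; rfl) ?_
      simp only [appWord_hole, List.length_append] at hl ⊢
      omega
    | holeLeft a' y =>
      simp only [before, after, appWord_hole, appWord_holeLeft, List.length_append,
        Diword.length_word] at *
      subst hb
      -- The center lies in `u` but to the right of `v`, hence in `e`.
      obtain ⟨r, hy, rfl⟩ := Diword.exists_right_split ha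
        (by simp only [List.length_append] at hl; omega)
      obtain ⟨l, x, r'⟩ := y
      simp only [Diword.mk.injEq, true_and] at hy
      subst hy
      refine ⟨hole a b, holeLeft c ⟨l, x, r⟩, by simp [comp], by simp [comp], hE, ?_, trivial⟩
      refine Diword.eq_of_word_eq (by rw [huv, word_appWord]; rfl) ?_
      simp only [appWord_holeLeft, List.length_append, Diword.length_word] at hl ⊢
      omega
    | holeRight y b' =>
      simp only [before, after, appWord_hole, appWord_holeRight, List.length_append,
        Diword.length_word] at *
      subst ha
      obtain ⟨l, hy, rfl⟩ := Diword.exists_left_split hb (by omega)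
      obtain ⟨l', x, r⟩ := y
      simp only [Diword.mk.injEq, and_true] at hy
      subst hy
      refine ⟨hole a b, holeRight ⟨l, x, r⟩ e, by simp [comp], by simp [comp], hE, ?_, trivial⟩
      refine Diword.eq_of_word_eq (by rw [huv, word_appWord]; rfl) ?_
      simp only [appWord_holeRight, List.length_append] at hl ⊢
      omega
  | holeLeft a y =>
    cases E with
    | hole a' b' =>
      simp only [before, after, appWord_hole, appWord_holeLeft, List.length_append,
        Diword.length_word] at *
      omega
    | holeLeft a' y' =>
      simp only [before, after, appWord_holeLeft, List.length_append, Diword.length_word] at *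
      subst hb
      obtain rfl : y' = ⟨e ++ y.left, y.center, y.right⟩ :=
        Diword.eq_of_word_eq (by rw [ha]; simp [Diword.word])
          (by simp only [List.length_append] at hl ⊢; omega)
      -- The surrounding context ignores the center of the inner diword, so that center may be
      -- chosen as the last letter, which makes the inner composition left normed.
      have h1 := leftNormed_leftHole c e hE
      refine ⟨holeLeft a y, leftHole c e, by simp [comp, before, after], by simp [comp], h1.1, ?_,
        leftNormed_leftHole [] [] hC, h1⟩
      exact Diword.eq_of_right_eq_nil (by rw [huv, word_appWord]; simp) hur
        (right_appWord_leftHole c e hvr)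
    | holeRight y' b' =>
      simp only [before, after, appWord_holeRight, appWord_holeLeft, List.length_append,
        Diword.length_word] at *
      omega
  | holeRight y b =>
    cases E with
    | hole a' b' =>
      simp only [before, after, appWord_hole, appWord_holeRight, List.length_append,
        Diword.length_word] at *
      omega
    | holeLeft a' y' =>
      simp only [before, after, appWord_holeRight, appWord_holeLeft, List.length_append,
        Diword.length_word] at *
      omega
    | holeRight y' b' =>
      simp only [before, after, appWord_holeRight, List.length_append, Diword.length_word] at *
      subst ha
      obtain rfl : y' = ⟨y.left, y.center, y.right ++ c⟩ :=
        Diword.eq_of_word_eq (by rw [hb]; simp [Diword.word]) hl.symm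
      have h1 := rightNormed_rightHole c e hE
      refine ⟨holeRight y b, rightHole c e, by simp [comp, before, after], by simp [comp], h1.1, ?_,
        rightNormed_rightHole [] [] hC, h1⟩
      exact Diword.eq_of_left_eq_nil (by rw [huv, word_appWord]; simp) hur
        (left_appWord_rightHole c e hvr)

/-- The two occurrences share `d` and together cover `c d e`; `O` is what surrounds this word. A
center in `c`, `d` or `e` makes the hole of `O` its center; a center outside forces `f` and `g` to
be normed on the same side. The case `c = []`, where `u` is a prefix of `v`, is included. -/
theorem app_sub_app_mem_of_intersection (hG : IsGroebnerShirshov S) {f g : FreeDialgebra k X}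
    (hf : f ∈ S) (hg : g ∈ S) {u v : Diword X} (hu : lead f = u) (hv : lead g = v)
    {C E : DiContext X} (hC : C.Normal f) (hE : E.Normal g) (hw : C.appWord u = E.appWord v)
    {c d e : List X} (hb : E.before = C.before ++ c) (ha : C.after = e ++ E.after)
    (hcd : u.word = c ++ d) (hde : v.word = d ++ e) (hd : d ≠ []) :
    C.app f - E.app g ∈ lowerSpan S (C.appWord u) := by
  have hl := congrArg (fun t : Diword X => t.left.length) hw
  have hbl := congrArg List.length hb
  have hal := congrArg List.length ha
  have hcdl := congrArg List.length hcd
  have hdel := congrArg List.length hde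
  have hdl := List.length_pos_iff.2 hd
  have hur : C.Fits u := hC.fits (mem_support_of_lead hu)
  have hvr : E.Fits v := hE.fits (mem_support_of_lead hv)
  suffices H : ∃ O C' E' : DiContext X, C = O.comp C' ∧ E = O.comp E' ∧ C'.Normal f ∧
      E'.Normal g ∧ C'.before = [] ∧ C'.after = e ∧ E'.before = c ∧ E'.after = [] ∧
      (C'.appWord u).left.length = (E'.appWord v).left.length ∧ (match O with
      | hole _ _ => True
      | holeLeft _ _ => C'.LeftNormed f ∧ E'.LeftNormed g
      | holeRight _ _ => C'.RightNormed f ∧ E'.RightNormed g) by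
    obtain ⟨O, C', E', rfl, rfl, hC', hE', hCb, hCa, hEb, hEa, huv, hO⟩ := H
    have := comp_app_sub_mem_lowerSpan hG hf hg (.intersection C' E' (C'.appWord u) u v hu hv
      hC' hE' hCb hEa rfl ?_ ?_) O hO
    · rwa [appWord_comp]
    · refine Diword.eq_of_word_eq ?_ huv
      rw [word_appWord, word_appWord, hCb, hCa, hEb, hEa, hcd, hde]; simp
    -- The composition has length `|c| + |d| + |e|`, which falls short of `|u| + |v|` by `|d| > 0`.
    · rw [Diword.length, word_appWord, hCb, hCa, List.length_append, List.length_append,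
        Diword.length, Diword.length, hde, List.length_append]
      simp only [List.length_nil]
      omega
  cases C with
  | hole a b =>
    cases E with
    | hole a' b' =>
      simp only [before, after, appWord_hole, List.length_append, Diword.length_word] at *
      subst hb ha
      refine ⟨hole a b', hole [] e, hole c [], by simp [comp], by simp [comp], trivial, trivial,
        rfl, rfl, rfl, rfl, ?_, trivial⟩
      simp only [appWord_hole, List.length_append] at hl ⊢
      simp only [List.length_nil]
      omega
    | holeLeft a' y =>
      simp only [before, after, appWord_hole, appWord_holeLeft, List.length_append,
        Diword.length_word] at *
      omega
    | holeRight y b' =>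
      simp only [before, after, appWord_hole, appWord_holeRight, List.length_append,
        Diword.length_word] at *
      subst ha
      obtain ⟨l, hy, rfl⟩ := Diword.exists_left_split hb (by omega)
      obtain ⟨l', x, r⟩ := y
      simp only [Diword.mk.injEq, and_true] at hy
      subst hy
      refine ⟨hole a b', hole [] e, holeRight ⟨l, x, r⟩ [], by simp [comp], by simp [comp],
        trivial, hE, rfl, rfl, rfl, rfl, ?_, trivial⟩
      simp only [appWord_hole, appWord_holeRight, List.length_append] at hl ⊢
      simp only [List.length_nil]
      omega
  | holeLeft a y =>
    cases E with
    | hole a' b' =>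
      simp only [before, after, appWord_hole, appWord_holeLeft, List.length_append,
        Diword.length_word] at *
      subst hb
      obtain ⟨r, hy, rfl⟩ := Diword.exists_right_split ha
        (by simp only [List.length_append] at hl; omega)
      obtain ⟨l, x, r'⟩ := y
      simp only [Diword.mk.injEq, true_and] at hy
      subst hy
      refine ⟨hole a b', holeLeft [] ⟨l, x, r⟩, hole c [], by simp [comp], by simp [comp],
        hC, trivial, rfl, rfl, rfl, rfl, ?_, trivial⟩
      simp only [appWord_hole, appWord_holeLeft, List.length_append, Diword.length_word] at hl ⊢
      simp only [List.length_nil]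
      omega
    | holeLeft a' y' =>
      simp only [before, after, appWord_holeLeft, List.length_append, Diword.length_word] at *
      subst hb
      obtain rfl : y = ⟨e ++ y'.left, y'.center, y'.right⟩ :=
        Diword.eq_of_word_eq (by rw [ha]; simp [Diword.word])
          (by simp only [List.length_append] at hl ⊢; omega)
      have h1 := leftNormed_leftHole [] e hC
      have h2 := leftNormed_leftHole c [] hE
      refine ⟨holeLeft a y', leftHole [] e, leftHole c [], by simp [comp], by simp [comp],
        h1.1, h2.1, before_leftHole [] e, after_leftHole [] e,
        before_leftHole c [], after_leftHole c [], ?_, h1, h2⟩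
      have := Diword.eq_of_right_eq_nil (u := (leftHole [] e).appWord u)
        (v := (leftHole c []).appWord v) (by simp [word_appWord, hcd, hde])
        (right_appWord_leftHole _ _ hur) (right_appWord_leftHole _ _ hvr)
      rw [this]
    | holeRight y' b' =>
      simp only [before, after, appWord_holeRight, appWord_holeLeft, List.length_append,
        Diword.length_word] at *
      omega
  | holeRight y b =>
    cases E with
    | hole a' b' =>
      simp only [before, after, appWord_hole, appWord_holeRight, List.length_append,
        Diword.length_word] at *
      omega
    | holeLeft a' y' =>
      simp only [before, after, appWord_holeRight, appWord_holeLeft, List.length_append,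
        Diword.length_word] at *
      omega
    | holeRight y' b' =>
      simp only [before, after, appWord_holeRight, List.length_append, Diword.length_word] at *
      subst ha
      obtain rfl : y' = ⟨y.left, y.center, y.right ++ c⟩ :=
        Diword.eq_of_word_eq (by rw [hb]; simp [Diword.word]) hl.symm
      have h1 := rightNormed_rightHole [] e hC
      have h2 := rightNormed_rightHole c [] hE
      refine ⟨holeRight y b', rightHole [] e, rightHole c [], by simp [comp], by simp [comp],
        h1.1, h2.1, before_rightHole [] e, after_rightHole [] e,
        before_rightHole c [], after_rightHole c [], ?_, h1, h2⟩
      rw [left_appWord_rightHole _ _ hur, left_appWord_rightHole _ _ hvr]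

/-- Two normal `S`-diwords with the same leading diword coincide modulo smaller normal
`S`-diwords. -/
theorem app_sub_app_mem_lowerSpan (hS : ∀ s ∈ S, Monic s) (hG : IsGroebnerShirshov S)
    {f g : FreeDialgebra k X} (hf : f ∈ S) (hg : g ∈ S) {u v : Diword X} (hu : lead f = u)
    (hv : lead g = v) {C E : DiContext X} (hC : C.Normal f) (hE : E.Normal g)
    (hw : C.appWord u = E.appWord v) : C.app f - E.app g ∈ lowerSpan S (C.appWord u) := by
  -- Exchanging the two `S`-diwords only changes the sign of the difference.
  wlog hle : C.before.length ≤ E.before.length generalizing f g u v C E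
  · rw [hw, ← neg_sub]
    exact Submodule.neg_mem _ (this hg hf hv hu hE hC hw.symm (by omega))
  have hword := congrArg Diword.word hw
  rw [word_appWord, word_appWord, List.append_assoc, List.append_assoc] at hword
  obtain ⟨c, hb, hc⟩ : ∃ c, E.before = C.before ++ c ∧
      u.word ++ C.after = c ++ (v.word ++ E.after) := by
    rcases List.append_eq_append_iff.1 hword with ⟨c, h1, h2⟩ | ⟨c, h1, h2⟩
    · exact ⟨c, h1, h2⟩
    · obtain rfl : c = [] := List.eq_nil_of_length_eq_zero
        (by rw [h1, List.length_append] at hle; omega)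
      exact ⟨[], by simpa using h1.symm, by simpa using h2.symm⟩
  -- Either `v` starts after `u` ends, or `u = c d` and `v` starts together with `d`; then `v` ends
  -- inside `u` or continues past it.
  rcases List.append_eq_append_iff.1 hc with ⟨c', rfl, ha⟩ | ⟨d, hcd, hd⟩
  · exact app_sub_app_mem_of_disjoint hS hf hg hu hv hC hE hw (c := c')
      (by rw [hb, List.append_assoc]) (by rw [ha, List.append_assoc])
  · rcases List.append_eq_append_iff.1 hd with ⟨e, rfl, ha⟩ | ⟨e, hde, ha⟩
    · exact app_sub_app_mem_of_inclusion hG hf hg hu hv hC hE hw hb ha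
        (by rw [hcd, List.append_assoc])
    -- If `d` is empty, the two occurrences are merely adjacent.
    · by_cases hd0 : d = []
      · subst hd0
        refine app_sub_app_mem_of_disjoint hS hf hg hu hv hC hE hw (c := []) ?_ ?_
        · rw [hb, hcd]; simp
        · rw [ha, hde]; simp
      · exact app_sub_app_mem_of_intersection hG hf hg hu hv hC hE hw hb ha hcd hde hd0

end FreeDialgebra

/-! ### The ideal generated by `S` -/

namespace FreeDialgebra

open DiContext

variable {k X : Type*} [Field k]

section

theorem app_mem_diIdeal {S : Set (FreeDialgebra k X)} {s : FreeDialgebra k X}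
    (hs : s ∈ diIdeal k S) (C : DiContext X) : C.app s ∈ diIdeal k S := by
  have hI := diIdeal_isDiIdeal k S
  have hv : ∀ (a : List X) (t : FreeDialgebra k X), t ∈ diIdeal k S →
      vdashList (of k) a t ∈ diIdeal k S := by
    intro a t ht
    induction a with
    | nil => exact ht
    | cons x a ih => exact (hI _ ih (of k x)).2.1
  have hd : ∀ (b : List X) (t : FreeDialgebra k X), t ∈ diIdeal k S →
      dashvList (of k) t b ∈ diIdeal k S := by
    intro b
    induction b with
    | nil => exact fun t ht => ht
    | cons x b ih => exact fun t ht => ih _ (hI t ht (of k x)).2.2.1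
  cases C with
  | hole a b => exact hd b _ (hv a _ hs)
  | holeLeft a v => exact hv a _ (hI s hs _).1
  | holeRight v b => exact hd b _ (hI s hs _).2.2.2

theorem subset_diIdeal (S : Set (FreeDialgebra k X)) : S ⊆ diIdeal k S := by
  intro s hs
  rw [diIdeal, SetLike.mem_coe, Submodule.mem_sInf]
  exact fun I hI => hI.2 hs

/-- This and the next three lemmas turn products with a basis diword into substitutions, so that
being an ideal reduces to closure under contexts. -/
theorem vdash_single_eq_app (f : FreeDialgebra k X) (v : Diword X) :
    f ⊢ᵈ (Finsupp.single v 1 : FreeDialgebra k X) = (holeLeft [] v).app f := by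
  rw [app, fill, eval_of]; rfl

theorem single_dashv_eq_app (f : FreeDialgebra k X) (v : Diword X) :
    (Finsupp.single v 1 : FreeDialgebra k X) ⊣ᵈ f = (holeRight v []).app f := by
  rw [app, fill, eval_of]; rfl

theorem single_vdash_eq_app (f : FreeDialgebra k X) (v : Diword X) :
    (Finsupp.single v 1 : FreeDialgebra k X) ⊢ᵈ f = (hole v.word []).app f := by
  rw [single_vdash, app_eq_mapDomain]
  congr 1
  funext u
  simp [DiMul.vdash]

theorem dashv_single_eq_app (f : FreeDialgebra k X) (v : Diword X) :
    f ⊣ᵈ (Finsupp.single v 1 : FreeDialgebra k X) = (hole [] v.word).app f := by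
  rw [dashv_single_right, app_eq_mapDomain]
  congr 1
  funext u
  simp [DiMul.dashv]

/-- A submodule that is closed under substitution into contexts is an ideal. -/
theorem isDiIdeal_of_app_mem {I : Submodule k (FreeDialgebra k X)}
    (h : ∀ f ∈ I, ∀ C : DiContext X, C.app f ∈ I) : IsDiIdeal I := by
  intro f hf d
  induction d using Finsupp.induction_linear with
  | zero =>
    -- The axioms yield products with zero through scalar compatibility.
    have h0 : (0 : FreeDialgebra k X) = (0 : k) • 0 := by simp
    rw [h0, Dialgebra.vdash_smul, Dialgebra.smul_vdash, Dialgebra.dashv_smul,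
      Dialgebra.smul_dashv]
    simp
  | add d e hd he =>
    rw [Dialgebra.vdash_add (k := k), Dialgebra.add_vdash (k := k), Dialgebra.dashv_add (k := k),
      Dialgebra.add_dashv (k := k)]
    exact ⟨I.add_mem hd.1 he.1, I.add_mem hd.2.1 he.2.1, I.add_mem hd.2.2.1 he.2.2.1,
      I.add_mem hd.2.2.2 he.2.2.2⟩
  | single v r =>
    have hr : (Finsupp.single v r : FreeDialgebra k X) = r • Finsupp.single v 1 := by simp
    rw [hr, Dialgebra.vdash_smul, Dialgebra.smul_vdash, Dialgebra.dashv_smul,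
      Dialgebra.smul_dashv, vdash_single_eq_app, single_vdash_eq_app, dashv_single_eq_app,
      single_dashv_eq_app]
    exact ⟨I.smul_mem _ (h f hf _), I.smul_mem _ (h f hf _), I.smul_mem _ (h f hf _),
      I.smul_mem _ (h f hf _)⟩

theorem mem_of_single_mem {N : Submodule k (FreeDialgebra k X)} {f : FreeDialgebra k X}
    (h : ∀ t, f t ≠ 0 → (Finsupp.single t 1 : FreeDialgebra k X) ∈ N) : f ∈ N := by
  rw [← Finsupp.sum_single f]
  refine N.sum_mem fun t ht => ?_
  have : (Finsupp.single t (f t) : FreeDialgebra k X) = f t • Finsupp.single t 1 := by simp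
  rw [this]
  exact N.smul_mem _ (h t (Finsupp.mem_support_iff.1 ht))

end

variable [LinearOrder X] {S : Set (FreeDialgebra k X)}

/-- If the compositions of multiplication are trivial, then every `S`-diword is a linear
combination of normal ones. -/
theorem app_mem_normalSpan_of_mem (hS : ∀ s ∈ S, Monic s) (hG : IsGroebnerShirshov S)
    {s : FreeDialgebra k X} (hs : s ∈ S) (C : DiContext X) : C.app s ∈ normalSpan S := by
  by_cases hC : C.Normal s
  · exact app_mem_normalSpan hS hs hC
  cases C with
  | hole a b => exact absurd trivial hC
  | holeLeft a v =>
    have hspan (x : X) := hG.2.1 s hs x hC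
    obtain ⟨l, x, r⟩ := v
    cases l with
    | nil =>
      -- The letter next to the hole is the center, so `s ⊢ x` occupies a central hole, where every
      -- normal `S`-diword stays normal.
      have : holeLeft a ⟨[], x, r⟩ = (hole a r).comp (holeLeft [] (Diword.of x)) := by
        simp [comp, Diword.of]
      rw [this, app_comp, ← vdash_single_eq_app]
      refine app_mem_of_mem_span _ ?_ (hspan x)
      rintro _ ⟨t, ht, B, u, hB, -, -, rfl⟩
      rw [← app_comp]
      exact app_mem_normalSpan hS ht (hB.hole_comp a r)
    | cons y l =>
      -- The product `s ⊢ y` is still to the left of the center. Its expansion uses left normed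
      -- `S`-diwords, which stay normal there.
      have : holeLeft a ⟨y :: l, x, r⟩ =
          (holeLeft a ⟨l, x, r⟩).comp (holeLeft [] (Diword.of y)) := by
        simp [comp, before, after, Diword.word, Diword.of]
      rw [this, app_comp, ← vdash_single_eq_app]
      refine app_mem_of_mem_span _ ?_ (hspan y)
      rintro _ ⟨t, ht, B, u, hB, -, hP, rfl⟩
      rw [← app_comp]
      exact app_mem_normalSpan hS ht (C := comp (holeLeft a _) B) hP.1.2.1
  | holeRight v b =>
    have hspan (x : X) := hG.1 s hs x hC
    obtain ⟨l, x, r⟩ := v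
    -- On this side the letter adjacent to the hole is the last letter of `v`, which is the center
    -- exactly when `r` is empty.
    rcases List.eq_nil_or_concat r with rfl | ⟨r, y, rfl⟩
    · have : holeRight ⟨l, x, []⟩ b = (hole l b).comp (holeRight (Diword.of x) []) := by
        simp [comp, Diword.of]
      rw [this, app_comp, ← single_dashv_eq_app]
      refine app_mem_of_mem_span _ ?_ (hspan x)
      rintro _ ⟨t, ht, B, u, hB, -, -, rfl⟩
      rw [← app_comp]
      exact app_mem_normalSpan hS ht (hB.hole_comp l b)
    · have : holeRight ⟨l, x, r ++ [y]⟩ b =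
          (holeRight ⟨l, x, r⟩ b).comp (holeRight (Diword.of y) []) := by
        simp [comp, before, after, Diword.word, Diword.of]
      rw [List.concat_eq_append, this, app_comp, ← single_dashv_eq_app]
      refine app_mem_of_mem_span _ ?_ (hspan y)
      rintro _ ⟨t, ht, B, u, hB, -, hP, rfl⟩
      rw [← app_comp]
      exact app_mem_normalSpan hS ht (C := comp (holeRight _ b) B) hP.1.2.1

/-- A context around a normal `S`-diword is again an `S`-diword, hence a combination of normal ones;
so the span is an ideal, and it contains `S` through the trivial context. -/
theorem diIdeal_le_normalSpan (hS : ∀ s ∈ S, Monic s) (hG : IsGroebnerShirshov S) :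
    diIdeal k S ≤ normalSpan S := by
  refine sInf_le ⟨isDiIdeal_of_app_mem fun f hf C => ?_, fun s hs => ?_⟩
  · refine app_mem_of_mem_span C ?_ hf
    rintro _ ⟨t, ht, B, u, -, -, -, rfl⟩
    rw [← app_comp]
    exact app_mem_normalSpan_of_mem hS hG ht _
  · have h := app_mem_normalSpan hS hs (C := hole [] []) trivial
    exact h

theorem normalDiwords_subset_diIdeal
    (P : DiContext X → FreeDialgebra k X → Diword X → Prop) :
    normalDiwords S P ⊆ diIdeal k S := by
  rintro _ ⟨s, hs, C, u, -, -, -, rfl⟩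
  exact app_mem_diIdeal (subset_diIdeal S hs) C

/-! ### The leading diwords of the ideal -/

/-- The span of the normal `S`-diwords with leading diword at most `w`. -/
noncomputable def upToSpan (S : Set (FreeDialgebra k X)) (w : Diword X) :
    Submodule k (FreeDialgebra k X) :=
  Submodule.span k (normalDiwords S fun _ _ u => u ≤ w)

theorem normalDiwords_mono {P Q : DiContext X → FreeDialgebra k X → Diword X → Prop}
    (h : ∀ C s u, P C s u → Q C s u) : normalDiwords S P ⊆ normalDiwords S Q := by
  rintro _ ⟨s, hs, C, u, hC, hu, hP, rfl⟩
  exact ⟨s, hs, C, u, hC, hu, h _ _ _ hP, rfl⟩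

theorem upToSpan_mono {w w' : Diword X} (h : w ≤ w') : upToSpan S w ≤ upToSpan S w' :=
  Submodule.span_mono (normalDiwords_mono fun _ _ _ hu => le_trans hu h)

theorem upToSpan_le_lowerSpan_of_not_reducible {w : Diword X} (hw : ¬ Reducible S w) :
    upToSpan S w ≤ lowerSpan S w := by
  refine Submodule.span_le.2 ?_
  rintro _ ⟨t, ht, E, v, hE, hv, hP, rfl⟩
  refine app_mem_lowerSpan ht hE hv (lt_of_le_of_ne hP ?_)
  rintro rfl
  exact hw ⟨t, ht, E, v, hE, hv, rfl⟩

/-- A nonempty finite combination has a largest leading diword. Zero is separate, since there may be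
no diword below `w`. -/
theorem mem_lowerSpan_cases {w : Diword X} {f : FreeDialgebra k X} (hf : f ∈ lowerSpan S w) :
    f = 0 ∨ ∃ w' < w, f ∈ upToSpan S w' := by
  induction hf using Submodule.span_induction with
  | mem f hf =>
    obtain ⟨s, hs, C, u, hC, hu, hP, rfl⟩ := hf
    exact Or.inr ⟨_, hP, Submodule.subset_span ⟨s, hs, C, u, hC, hu, le_rfl, rfl⟩⟩
  | zero => exact Or.inl rfl
  | add f g _ _ hf hg =>
    rcases hf with rfl | ⟨w₁, h₁, hf⟩
    · simpa using hg
    rcases hg with rfl | ⟨w₂, h₂, hg⟩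
    · rw [add_zero]; exact Or.inr ⟨w₁, h₁, hf⟩
    exact Or.inr ⟨max w₁ w₂, max_lt h₁ h₂, Submodule.add_mem _
      (upToSpan_mono (le_max_left _ _) hf) (upToSpan_mono (le_max_right _ _) hg)⟩
  | smul r f _ hf =>
    rcases hf with rfl | ⟨w', h, hf⟩
    · simp
    · exact Or.inr ⟨w', h, Submodule.smul_mem _ _ hf⟩

theorem mem_normalSpan_cases {f : FreeDialgebra k X} (hf : f ∈ normalSpan S) :
    f = 0 ∨ ∃ w, f ∈ upToSpan S w := by
  induction hf using Submodule.span_induction with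
  | mem f hf =>
    obtain ⟨s, hs, C, u, hC, hu, hP, rfl⟩ := hf
    exact Or.inr ⟨_, Submodule.subset_span ⟨s, hs, C, u, hC, hu, le_rfl, rfl⟩⟩
  | zero => exact Or.inl rfl
  | add f g _ _ hf hg =>
    rcases hf with rfl | ⟨w₁, hf⟩
    · simpa using hg
    rcases hg with rfl | ⟨w₂, hg⟩
    · rw [add_zero]; exact Or.inr ⟨w₁, hf⟩
    exact Or.inr ⟨max w₁ w₂, Submodule.add_mem _
      (upToSpan_mono (le_max_left _ _) hf) (upToSpan_mono (le_max_right _ _) hg)⟩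
  | smul r f _ hf =>
    rcases hf with rfl | ⟨w', hf⟩
    · simp
    · exact Or.inr ⟨w', Submodule.smul_mem _ _ hf⟩

/-- Elements of `lowerSpan S w` involve only diwords less than `w`. -/
theorem lt_of_mem_lowerSpan {w : Diword X} {f : FreeDialgebra k X} (hf : f ∈ lowerSpan S w)
    {t : Diword X} (ht : f t ≠ 0) : t < w := by
  have h : lowerSpan S w ≤ Finsupp.supported k k (Set.Iio w) := by
    refine Submodule.span_le.2 ?_
    rintro _ ⟨s, hs, C, u, hC, hu, hP, rfl⟩
    rw [SetLike.mem_coe, Finsupp.mem_supported]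
    exact fun t ht => lt_of_le_of_lt (le_of_lead (lead_app hC hu) ht) hP
  exact (Finsupp.mem_supported k f).1 (h hf) (Finsupp.mem_support_iff.2 ht)

/-- Given a normal `S`-diword with leading diword `w`, the others with that leading diword can be
eliminated. -/
theorem exists_sub_smul_mem_lowerSpan (hS : ∀ s ∈ S, Monic s) (hG : IsGroebnerShirshov S)
    {s : FreeDialgebra k X} (hs : s ∈ S) {C : DiContext X} {u : Diword X} (hC : C.Normal s)
    (hu : lead s = u) {f : FreeDialgebra k X} (hf : f ∈ upToSpan S (C.appWord u)) :
    ∃ r : k, f - r • C.app s ∈ lowerSpan S (C.appWord u) := by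
  induction hf using Submodule.span_induction with
  | mem f hf =>
    obtain ⟨t, ht, E, v, hE, hv, hP, rfl⟩ := hf
    rcases hP.lt_or_eq with hlt | heq
    · exact ⟨0, by simpa using app_mem_lowerSpan ht hE hv hlt⟩
    · refine ⟨1, ?_⟩
      rw [one_smul, ← heq]
      exact app_sub_app_mem_lowerSpan hS hG ht hs hv hu hE hC heq
  | zero => exact ⟨0, by simp⟩
  | add f g _ _ hf hg =>
    obtain ⟨r, hr⟩ := hf
    obtain ⟨r', hr'⟩ := hg
    refine ⟨r + r', ?_⟩
    rw [add_smul, add_sub_add_comm]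
    exact Submodule.add_mem _ hr hr'
  | smul c f _ hf =>
    obtain ⟨r, hr⟩ := hf
    refine ⟨c * r, ?_⟩
    rw [mul_smul, ← smul_sub]
    exact Submodule.smul_mem _ _ hr

/-- Induction on the bound `w`. Terms with leading diword `w` merge into one multiple of a chosen
`S`-diword: a nonzero coefficient makes `w` the leading diword of `f`, a zero one lowers the bound.
-/
theorem reducible_lead_of_mem_upToSpan [WellFoundedLT X] (hS : ∀ s ∈ S, Monic s)
    (hG : IsGroebnerShirshov S) (w : Diword X) : ∀ f ∈ upToSpan S w, f ≠ 0 →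
      ∃ u : Diword X, lead f = u ∧ Reducible S u := by
  induction w using WellFoundedLT.induction with
  | ind w ih =>
    intro f hf hf0
    have hlow : f ∈ lowerSpan S w → ∃ u : Diword X, lead f = u ∧ Reducible S u := by
      intro h
      rcases mem_lowerSpan_cases h with rfl | ⟨w', hw', h'⟩
      · exact absurd rfl hf0
      · exact ih w' hw' f h' hf0
    by_cases hw : Reducible S w
    · obtain ⟨s, hs, C, u, hC, hu, rfl⟩ := id hw
      obtain ⟨r, hr⟩ := exists_sub_smul_mem_lowerSpan hS hG hs hC hu hf
      by_cases hr0 : r = 0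
      · subst hr0
        exact hlow (by simpa using hr)
      -- The remainder involves only diwords below `w`, so the coefficient of `f` at `w` is `r ≠ 0`,
      -- and nothing above `w` occurs in `f`.
      refine ⟨_, lead_eq_coe_iff.2 ⟨fun h0 => ?_, fun t ht => ?_⟩, hw⟩
      · refine lt_irrefl _ (lt_of_mem_lowerSpan hr (t := C.appWord u) ?_)
        rw [Finsupp.sub_apply, Finsupp.smul_apply, h0, hC.app_apply (mem_support_of_lead hu),
          (hS s hs).apply_lead hu]
        simpa using hr0
      · by_contra! hlt
        refine (lt_of_mem_lowerSpan hr (t := t) ?_).not_ge hlt.le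
        have h0 : C.app s t = 0 := by
          by_contra h0
          exact (le_of_lead (lead_app hC hu) (Finsupp.mem_support_iff.2 h0)).not_gt hlt
        rwa [Finsupp.sub_apply, Finsupp.smul_apply, h0, smul_zero, sub_zero]
    · exact hlow (upToSpan_le_lowerSpan_of_not_reducible hw hf)

theorem IsGroebnerShirshov.leadProperty [WellFoundedLT X] (hS : ∀ s ∈ S, Monic s)
    (hG : IsGroebnerShirshov S) : LeadProperty S := by
  intro f hf hf0
  rcases mem_normalSpan_cases (diIdeal_le_normalSpan hS hG hf) with rfl | ⟨w, hw⟩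
  · exact absurd rfl hf0
  · exact reducible_lead_of_mem_upToSpan hS hG w f hw hf0

/-! ### Reduction to irreducible diwords -/

/-- The span of the irreducible diwords at most `w`. -/
noncomputable def irrSpan (S : Set (FreeDialgebra k X)) (w : Diword X) :
    Submodule k (FreeDialgebra k X) :=
  Finsupp.supported k k (Irr S ∩ Set.Iic w)

theorem irrSpan_sup_mono {w w' : Diword X} (h : w ≤ w') :
    irrSpan S w ⊔ upToSpan S w ≤ irrSpan S w' ⊔ upToSpan S w' :=
  sup_le_sup (Finsupp.supported_mono fun _ hx => ⟨hx.1, le_trans hx.2 h⟩) (upToSpan_mono h)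

/-- One division step: a reducible `w` is the leading diword of some normal `S`-diword, and
subtracting the latter leaves only smaller diwords. -/
theorem single_mem_irrSpan_sup [WellFoundedLT X] (hS : ∀ s ∈ S, Monic s) (w : Diword X) :
    (Finsupp.single w 1 : FreeDialgebra k X) ∈ irrSpan S w ⊔ upToSpan S w := by
  induction w using WellFoundedLT.induction with
  | ind w ih =>
    by_cases hw : Reducible S w
    · obtain ⟨s, hs, C, u, hC, hu, rfl⟩ := hw
      have hlead := lead_app hC hu
      have h1 : C.app s ∈ upToSpan S (C.appWord u) :=
        Submodule.subset_span ⟨s, hs, C, u, hC, hu, le_rfl, rfl⟩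
      have h2 : C.app s - Finsupp.single (C.appWord u) 1 ∈
          irrSpan S (C.appWord u) ⊔ upToSpan S (C.appWord u) := by
        refine mem_of_single_mem fun t ht => ?_
        have hne : t ≠ C.appWord u := by
          rintro rfl
          rw [Finsupp.sub_apply, hC.app_apply (mem_support_of_lead hu),
            (hS s hs).apply_lead hu] at ht
          simp at ht
        rw [Finsupp.sub_apply, Finsupp.single_eq_of_ne hne, sub_zero] at ht
        have hlt := lt_of_le_of_ne (le_of_lead hlead (Finsupp.mem_support_iff.2 ht)) hne
        exact irrSpan_sup_mono hlt.le (ih t hlt)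
      have := Submodule.sub_mem _ (Submodule.mem_sup_right h1) h2
      rwa [sub_sub_cancel] at this
    · exact Submodule.mem_sup_left (Finsupp.single_mem_supported k _ ⟨hw, Set.self_mem_Iic⟩)

theorem mem_irrSpan_sup [WellFoundedLT X] (hS : ∀ s ∈ S, Monic s) {w : Diword X}
    {f : FreeDialgebra k X} (hf : ∀ t, f t ≠ 0 → t ≤ w) : f ∈ irrSpan S w ⊔ upToSpan S w := by
  refine mem_of_single_mem fun t ht => ?_
  exact irrSpan_sup_mono (hf t ht) (single_mem_irrSpan_sup hS t)

theorem upToSpan_le_diIdeal (w : Diword X) : upToSpan S w ≤ diIdeal k S :=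
  Submodule.span_le.2 (normalDiwords_subset_diIdeal _)

/-- No nonzero combination of irreducible diwords lies in the ideal. -/
def IrrIndependent (S : Set (FreeDialgebra k X)) : Prop :=
  ∀ f ∈ diIdeal k S, f ∈ Finsupp.supported k k (Irr S) → f = 0

theorem LeadProperty.irrIndependent (h : LeadProperty S) : IrrIndependent S := by
  intro f hf hsupp
  by_contra hf0
  obtain ⟨u, hu, hred⟩ := h f hf hf0
  exact (Finsupp.mem_supported k f).1 hsupp (mem_support_of_lead hu) hred

/-- Division of `f` leaves an irreducible part which again lies in the ideal, hence vanishes. -/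
theorem IrrIndependent.mem_upToSpan [WellFoundedLT X] (hS : ∀ s ∈ S, Monic s)
    (h : IrrIndependent S) {f : FreeDialgebra k X} (hf : f ∈ diIdeal k S) {w : Diword X}
    (hw : ∀ t, f t ≠ 0 → t ≤ w) : f ∈ upToSpan S w := by
  obtain ⟨g, hg, g', hg', rfl⟩ := Submodule.mem_sup.1 (mem_irrSpan_sup hS hw)
  have hgI : g ∈ diIdeal k S := by
    have := Submodule.sub_mem _ hf (upToSpan_le_diIdeal w hg')
    rwa [add_sub_cancel_right] at this
  rw [h g hgI (Finsupp.supported_mono Set.inter_subset_left hg), zero_add]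
  exact hg'

/-- If the leading diword `w` were irreducible, no normal `S`-diword would have it as leading
diword. The expansion of `f` bounded by `w` would then use only diwords below `w`, yet `w` occurs in
`f`. -/
theorem IrrIndependent.leadProperty [WellFoundedLT X] (hS : ∀ s ∈ S, Monic s)
    (h : IrrIndependent S) : LeadProperty S := by
  intro f hf hf0
  obtain ⟨w, hw⟩ := exists_lead_eq hf0
  refine ⟨w, hw, ?_⟩
  by_contra hirr
  have hmem := h.mem_upToSpan hS hf (lead_eq_coe_iff.1 hw).2
  exact lt_irrefl _ (lt_of_mem_lowerSpan (upToSpan_le_lowerSpan_of_not_reducible hirr hmem)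
    (lead_eq_coe_iff.1 hw).1)

/-- A relation between the images is a combination of irreducible diwords that lies in the ideal. -/
theorem linearIndependent_irr_iff :
    LinearIndependent k (fun u : Irr S =>
      (diIdeal k S).mkQ (Finsupp.single (u : Diword X) (1 : k))) ↔ IrrIndependent S := by
  have key (l : Irr S →₀ k) : Finsupp.linearCombination k (fun u : Irr S =>
      (diIdeal k S).mkQ (Finsupp.single (u : Diword X) (1 : k))) l =
      (diIdeal k S).mkQ (l.mapDomain Subtype.val) := by
    induction l using Finsupp.induction_linear with
    | zero => simp
    | add f g hf hg => rw [map_add, hf, hg, Finsupp.mapDomain_add, map_add]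
    | single u r =>
      rw [Finsupp.linearCombination_single, Finsupp.mapDomain_single, ← map_smul]
      simp
  rw [linearIndependent_iff]
  simp only [key]
  simp only [Submodule.mkQ_apply, Submodule.Quotient.mk_eq_zero]
  constructor
  · intro h f hf hsupp
    obtain ⟨l, rfl⟩ : ∃ l : Irr S →₀ k, l.mapDomain Subtype.val = f := by
      refine ⟨_, Finsupp.mapDomain_comapDomain _ Subtype.val_injective f ?_⟩
      rw [Subtype.range_coe]
      exact (Finsupp.mem_supported k f).1 hsupp
    rw [h l hf, Finsupp.mapDomain_zero]
  · intro h l hl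
    refine Finsupp.mapDomain_injective Subtype.val_injective ?_
    rw [Finsupp.mapDomain_zero]
    refine h _ hl fun t ht => ?_
    classical
    obtain ⟨u, -, rfl⟩ := Finset.mem_image.1 (Finsupp.mapDomain_support ht)
    exact u.2

theorem span_irr_eq_top [WellFoundedLT X] (hS : ∀ s ∈ S, Monic s) :
    Submodule.span k (Set.range fun u : Irr S =>
      (diIdeal k S).mkQ (Finsupp.single (u : Diword X) (1 : k))) = ⊤ := by
  set N := Submodule.span k (Set.range fun u : Irr S =>
      (diIdeal k S).mkQ (Finsupp.single (u : Diword X) (1 : k)))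
  suffices h : ∀ f : FreeDialgebra k X, f ∈ N.comap (diIdeal k S).mkQ by
    rw [eq_top_iff]
    rintro q -
    obtain ⟨f, rfl⟩ := (diIdeal k S).mkQ_surjective q
    exact h f
  refine fun f => mem_of_single_mem fun t _ => ?_
  refine (sup_le ?_ ?_ : irrSpan S t ⊔ upToSpan S t ≤ _) (single_mem_irrSpan_sup hS t)
  · refine fun g hg => mem_of_single_mem fun v hv => ?_
    have hv' := (Finsupp.mem_supported k g).1 hg (Finsupp.mem_support_iff.2 hv)
    exact Submodule.subset_span ⟨⟨v, hv'.1⟩, rfl⟩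
  · intro g hg
    rw [Submodule.mem_comap, Submodule.mkQ_apply,
      (Submodule.Quotient.mk_eq_zero _).2 (upToSpan_le_diIdeal t hg)]
    exact N.zero_mem

theorem irrIsBasis_iff [WellFoundedLT X] (hS : ∀ s ∈ S, Monic s) :
    IrrIsBasis S ↔ IrrIndependent S :=
  ⟨fun h => linearIndependent_irr_iff.1 h.1,
    fun h => ⟨linearIndependent_irr_iff.2 h, span_irr_eq_top hS⟩⟩

/-! ### Triviality of compositions -/

theorem IrrIndependent.mem_span_le_lead [WellFoundedLT X] (hS : ∀ s ∈ S, Monic s)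
    (h : IrrIndependent S) {f : FreeDialgebra k X} (hf : f ∈ diIdeal k S) :
    f ∈ Submodule.span k (normalDiwords S fun _ _ u => (u : WithBot (Diword X)) ≤ lead f) := by
  by_cases hf0 : f = 0
  · rw [hf0]; exact Submodule.zero_mem _
  obtain ⟨w, hw⟩ := exists_lead_eq hf0
  simp only [hw, WithBot.coe_le_coe]
  exact h.mem_upToSpan hS hf (lead_eq_coe_iff.1 hw).2

/-- Both `S`-diwords have leading diword `w` with coefficient 1, so these terms cancel. -/
theorem IsComposition.lead_sub_lt (hS : ∀ s ∈ S, Monic s) {f g : FreeDialgebra k X} (hf : f ∈ S)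
    (hg : g ∈ S) {C E : DiContext X} {w : Diword X} (h : IsComposition f g C E w) :
    lead (C.app f - E.app g) < w := by
  obtain ⟨⟨hC, u, hu, hwu⟩, hE, v, hv, hwv⟩ := h.exists_lead
  have hCl := lead_app hC hu
  have hEl := lead_app hE hv
  have hCw : C.app f w = 1 := by
    rw [hwu, hC.app_apply (mem_support_of_lead hu), (hS f hf).apply_lead hu]
  have hEw : E.app g w = 1 := by
    rw [hwv, hE.app_apply (mem_support_of_lead hv), (hS g hg).apply_lead hv]
  rw [← hwu] at hCl
  rw [← hwv] at hEl
  by_cases h0 : C.app f - E.app g = 0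
  · rw [h0]; exact WithBot.bot_lt_coe w
  obtain ⟨t, ht⟩ := exists_lead_eq h0
  have ht' := (lead_eq_coe_iff.1 ht).1
  rw [Finsupp.sub_apply] at ht'
  rw [ht, WithBot.coe_lt_coe]
  refine lt_of_le_of_ne ?_ ?_
  · by_contra hlt
    apply ht'
    rw [not_imp_comm.1 ((lead_eq_coe_iff.1 hCl).2 t) hlt,
      not_imp_comm.1 ((lead_eq_coe_iff.1 hEl).2 t) hlt, sub_zero]
  · rintro rfl
    rw [hCw, hEw, sub_self] at ht'
    exact ht' rfl

/-- Every composition lies in `Id(S)`, so division bounds its expansion by its own leading diword,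
which is below `w` for inclusions and intersections. -/
theorem IrrIndependent.compositionsTrivial [WellFoundedLT X] (hS : ∀ s ∈ S, Monic s)
    (h : IrrIndependent S) : CompositionsTrivial S := by
  have hI := diIdeal_isDiIdeal k S
  refine ⟨fun f hf x _ => h.mem_span_le_lead hS (hI f (subset_diIdeal S hf) _).2.2.2,
    fun f hf x _ => h.mem_span_le_lead hS (hI f (subset_diIdeal S hf) _).1,
    fun f hf g hg C E w hc => ?_⟩
  refine Submodule.span_mono (normalDiwords_mono fun _ _ u hu => ⟨hu, ?_⟩)
    (h.mem_span_le_lead hS (Submodule.sub_mem _ (app_mem_diIdeal (subset_diIdeal S hf) C)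
      (app_mem_diIdeal (subset_diIdeal S hg) E)))
  exact WithBot.coe_lt_coe.1 (lt_of_le_of_lt hu (hc.lead_sub_lt hS hf hg))

end FreeDialgebra

theorem mainTheorem2 {k X : Type*} [Field k] [LinearOrder X] [WellFoundedLT X]
    (S : Set (FreeDialgebra k X)) (hS : ∀ s ∈ S, FreeDialgebra.Monic s) :
    (FreeDialgebra.IsGroebnerShirshov S → FreeDialgebra.LeadProperty S) ∧
    (FreeDialgebra.LeadProperty S ↔ FreeDialgebra.IrrIsBasis S) ∧
    (FreeDialgebra.IrrIsBasis S → FreeDialgebra.CompositionsTrivial S) := by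
  rw [FreeDialgebra.irrIsBasis_iff hS]
  exact ⟨fun h => h.leadProperty hS, ⟨fun h => h.irrIndependent, fun h => h.leadProperty hS⟩,
    fun h => h.compositionsTrivial hS⟩
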